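/- **Theorem 1.4.** There exist universal constants $c, C, C' > 0$ such that the following holds. Let $\ell \ge 2$ and $n_1,\dots,n_\ell$ be integers, and let $X^{(j)}$, $1\le j\le \ell$, be independent random vectors in $\mathbb{R}^{n_j}$ that are log-concave (the law of $X^{(j)}$ has a density $g$ with respect to Lebesgue measure such that $g(\theta x+(1-\theta)y)\ge g(x)^{\theta}g(y)^{1-\theta}$ for all $x,y$ in the support of $g$ and $\theta\in(0,1)$) and isotropic ($\mathbb{E}[X^{(j)}(X^{(j)})^{T}]=\mathrm{Id}$). Equip the space $\mathbb{R}^{n_1\otimes\cdots\otimes n_\ell}$ of real arrays $(T_{i_1\cdots i_\ell})$ with the inner product $\langle S,T\rangle=\sum_{i_1,\dots,i_\ell}S_{i_1\cdots i_\ell}T_{i_1\cdots i_\ell}$ and its norm $\|\cdot\|_2$, and let $X^{(1)}\otimes\cdots\otimes X^{(\ell)}=\big(X^{(1)}_{i_1}\cdots X^{(\ell)}_{i_\ell}\big)_{i_1\cdots i_\ell}$. Let $F$ be a linear subspace of $\mathbb{R}^{n_1\otimes\cdots\otimes n_\ell}$ of dimension $m\ge 1$, let $f^{(1)},\dots,f^{(m)}$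 be an orthonormal basis of $F$, and let $\Pi_F$ be the orthogonal projection onto $F$. Then for every $0<\varepsilon<e^{-c\ell}$ and every $1\le k\le m$, $$\mathbb{P}\left(\left|\langle X^{(1)}\otimes\cdots\otimes X^{(\ell)},f^{(k)}\rangle\right|\le\varepsilon\right)\le\frac{\varepsilon}{(\ell-1)!}\left(C\log\frac1\varepsilon\right)^{\ell-1},$$ and $$\mathbb{P}\left(\left\|\Pi_F\big(X^{(1)}\otimes\cdots\otimes X^{(\ell)}\big)\right\|_2\le\varepsilon\sqrt m\right)\le\min\left\{m,\,{C'}^{\ell}\log\frac1\varepsilon\right\}\frac{\varepsilon}{(\ell-1)!}\left(C\log\frac1\varepsilon\right)^{\ell-1}.$$ -/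

import Mathlib

open MeasureTheory ProbabilityTheory

/-- A nonnegative function on `ℝⁿ` is log-concave if
`f (θ x + (1 - θ) y) ≥ f(x) ^ θ f(y) ^ (1 - θ)` for `x, y` in its support and `θ ∈ (0, 1)`. -/
def IsLogConcaveFun {n : ℕ} (f : EuclideanSpace ℝ (Fin n) → ℝ) : Prop :=
  (∀ x, 0 ≤ f x) ∧
    ∀ x ∈ Function.support f, ∀ y ∈ Function.support f, ∀ θ : ℝ, 0 < θ → θ < 1 →
      f x ^ θ * f y ^ (1 - θ) ≤ f (θ • x + (1 - θ) • y)

/-- A random vector in `ℝⁿ` is log-concave if its law has a log-concave density with respect to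
Lebesgue measure. -/
def IsLogConcaveVector {Ω : Type*} [MeasurableSpace Ω] (P : Measure Ω) {n : ℕ}
    (X : Ω → EuclideanSpace ℝ (Fin n)) : Prop :=
  ∃ f : EuclideanSpace ℝ (Fin n) → ℝ, Measurable f ∧ IsLogConcaveFun f ∧
    P.map X = (volume : Measure (EuclideanSpace ℝ (Fin n))).withDensity
      (fun x => ENNReal.ofReal (f x))

/-- A random vector in `ℝⁿ` is isotropic if `E[X Xᵀ] = Id` (entrywise, all entries integrable). -/
def IsIsotropicVector {Ω : Type*} [MeasurableSpace Ω] (P : Measure Ω) {n : ℕ}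
    (X : Ω → EuclideanSpace ℝ (Fin n)) : Prop :=
  ∀ i j : Fin n, Integrable (fun ω => X ω i * X ω j) P ∧
    ∫ ω, X ω i * X ω j ∂P = (1 : Matrix (Fin n) (Fin n) ℝ) i j

/-- Real tensors of format `n₁ × ⋯ × n_ℓ`, i.e. multidimensional arrays `(T_{i₁ ⋯ i_ℓ})`, with the
Frobenius inner product and norm. -/
abbrev RealTensor {ℓ : ℕ} (n : Fin ℓ → ℕ) : Type :=
  EuclideanSpace ℝ ((j : Fin ℓ) → Fin (n j))

/-- The simple tensor `x⁽¹⁾ ⊗ ⋯ ⊗ x⁽ℓ⁾`, with entries `x⁽¹⁾_{i₁} ⋯ x⁽ℓ⁾_{i_ℓ}`. -/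
noncomputable def simpleTensor {ℓ : ℕ} {n : Fin ℓ → ℕ}
    (x : (j : Fin ℓ) → EuclideanSpace ℝ (Fin (n j))) : RealTensor n :=
  WithLp.toLp 2 (fun i => ∏ j, x j (i j))

open scoped ENNReal Pointwise

/-! The factors are integrated out one at a time, and what is tracked is a negative moment of order
`p < 1`. Prékopa–Leindler makes one-dimensional marginals of a log-concave density log-concave, and
a log-concave law on the line with unit second moment gives `[-t, t]` mass at most `C t`
(`IsLogConcaveMeasure.smallBall`). Hence `E |⟨X, v⟩| ^ (-p) ≤ C / (1 - p)` for unit `v`, in every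
dimension.

Pairing a tensor with a simple tensor equals pairing the first factor with a contraction, whose
coordinates are pairings of shorter simple tensors with slices. Induction controls the negative
moments of these coordinates, and convexity of `s ↦ s ^ (-p / 2)` carries the bound to the norm
without loss (`lintegral_enorm_rpow_neg_le`). Each factor therefore costs exactly one `C / (1 - p)`.

With `d = ℓ - 1` and `L = log (1 / ε)`, using the small ball bound on one factor and moments on the
other `d` gives `C ε ^ p (C / (1 - p)) ^ d`. The optimal choice `1 - p = d / L` turns this into `C ε
e ^ d (C L / d) ^ d`, and `d! ≤ d ^ d` finishes. For the projection, a union bound over the basis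
costs the factor `m`; Markov's inequality for the negative moment of the norm instead costs one
further factor `C L / d`. -/

/-! ### The Prékopa–Leindler inequality in `ℝⁿ`. -/

/-- A measure satisfies the Prékopa–Leindler inequality. -/
def PrekopaLeindler {E : Type*} [AddCommGroup E] [Module ℝ E] [MeasurableSpace E]
    (μ : Measure E) : Prop :=
  ∀ ⦃θ : ℝ⦄, 0 < θ → θ < 1 → ∀ ⦃f g h : E → ℝ≥0∞⦄, Measurable f → Measurable g → Measurable h →
    (∀ x y, f x ^ θ * g y ^ (1 - θ) ≤ h (θ • x + (1 - θ) • y)) →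
    (∫⁻ x, f x ∂μ) ^ θ * (∫⁻ x, g x ∂μ) ^ (1 - θ) ≤ ∫⁻ x, h x ∂μ

/-- The one-dimensional Brunn–Minkowski inequality for compact sets. -/
lemma volume_add_volume_le_of_isCompact {θ : ℝ} (h0 : 0 < θ) (h1 : θ < 1) {K L C : Set ℝ}
    (hK : IsCompact K) (hL : IsCompact L) (hKn : K.Nonempty) (hLn : L.Nonempty)
    (h : ∀ x ∈ K, ∀ y ∈ L, θ * x + (1 - θ) * y ∈ C) :
    ENNReal.ofReal θ * volume K + ENNReal.ofReal (1 - θ) * volume L ≤ volume C := by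
  obtain ⟨a, haK, ha⟩ := hK.exists_isGreatest hKn
  obtain ⟨b, hbL, hb⟩ := hL.exists_isLeast hLn
  have h1' : 0 < 1 - θ := by linarith
  -- Attaching `K` to the minimum of `L`, and `L` to the maximum of `K`, gives two sets inside `C`
  -- that meet in at most the point `θ a + (1 - θ) b`, so their measures add.
  set S₁ : Set ℝ := ((1 - θ) * b) +ᵥ (θ • K)
  set S₂ : Set ℝ := (θ * a) +ᵥ ((1 - θ) • L)
  have e₁ : volume S₁ = ENNReal.ofReal θ * volume K := by
    simp [S₁, Measure.addHaar_smul, abs_of_pos h0]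
  have e₂ : volume S₂ = ENNReal.ofReal (1 - θ) * volume L := by
    simp [S₂, Measure.addHaar_smul, abs_of_pos h1']
  have hS₂ : IsCompact S₂ := (hL.smul (1 - θ)).vadd _
  have hsub : S₁ ∪ S₂ ⊆ C := by
    rintro _ (⟨_, ⟨x, hx, rfl⟩, rfl⟩ | ⟨_, ⟨x, hx, rfl⟩, rfl⟩)
    · have := h x hx b hbL
      simpa [add_comm] using this
    · simpa using h a haK x hx
  have hd : AEDisjoint volume S₁ S₂ := by
    refine measure_mono_null (t := {θ * a + (1 - θ) * b}) ?_ (by simp)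
    rintro z ⟨⟨_, ⟨x, hx, rfl⟩, rfl⟩, ⟨_, ⟨y, hy, rfl⟩, hz⟩⟩
    simp only [smul_eq_mul, vadd_eq_add, Set.mem_singleton_iff] at hz ⊢
    have := mul_le_mul_of_nonneg_left (ha hx) h0.le
    have := mul_le_mul_of_nonneg_left (hb hy) h1'.le
    linarith
  rw [← e₁, ← e₂, ← measure_union₀ hS₂.measurableSet.nullMeasurableSet hd]
  exact measure_mono hsub

/-- The one-dimensional Brunn–Minkowski inequality. -/
lemma volume_add_volume_le {θ : ℝ} (h0 : 0 < θ) (h1 : θ < 1) {A B C : Set ℝ}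
    (hA : MeasurableSet A) (hB : MeasurableSet B) (hAn : A.Nonempty) (hBn : B.Nonempty)
    (h : ∀ x ∈ A, ∀ y ∈ B, θ * x + (1 - θ) * y ∈ C) :
    ENNReal.ofReal θ * volume A + ENNReal.ofReal (1 - θ) * volume B ≤ volume C := by
  have key : ∀ S : Set ℝ, MeasurableSet S → S.Nonempty →
      volume S = ⨆ K : {K : Set ℝ // K ⊆ S ∧ IsCompact K ∧ K.Nonempty}, volume K.1 := by
    rintro S hS ⟨s, hs⟩
    refine le_antisymm ?_ (iSup_le fun K => measure_mono K.2.1)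
    rw [hS.measure_eq_iSup_isCompact]
    refine iSup_le fun K => iSup_le fun hKS => iSup_le fun hK => ?_
    refine le_trans (measure_mono (Set.subset_insert s K))
      (le_iSup (fun K : {K : Set ℝ // K ⊆ S ∧ IsCompact K ∧ K.Nonempty} => volume K.1)
        ⟨insert s K, Set.insert_subset hs hKS, hK.insert s, Set.insert_nonempty _ _⟩)
  have ne : ∀ S : Set ℝ, S.Nonempty → Nonempty {K : Set ℝ // K ⊆ S ∧ IsCompact K ∧ K.Nonempty} :=
    fun S ⟨s, hs⟩ => ⟨⟨{s}, by simpa using hs, isCompact_singleton, by simp⟩⟩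
  have := ne A hAn
  have := ne B hBn
  rw [key A hA hAn, key B hB hBn, ENNReal.mul_iSup, ENNReal.mul_iSup]
  exact ENNReal.iSup_add_iSup_le fun K L =>
    volume_add_volume_le_of_isCompact h0 h1 K.2.2.1 L.2.2.1 K.2.2.2 L.2.2.2
      fun x hx y hy => h x (K.2.1 hx) y (L.2.1 hy)

lemma lintegral_eq_setLIntegral_Ioo_meas_lt {α : Type*} [MeasurableSpace α] (μ : Measure α)
    {f : α → ℝ≥0∞} (hf : Measurable f) (hf1 : ∀ x, f x ≤ 1) :
    ∫⁻ x, f x ∂μ = ∫⁻ t in Set.Ioo (0 : ℝ) 1, μ {x | ENNReal.ofReal t < f x} := by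
  have hfin : ∀ x, f x ≠ ∞ := fun x => ne_top_of_le_ne_top ENNReal.one_ne_top (hf1 x)
  have e := lintegral_eq_lintegral_meas_lt μ (f := fun x => (f x).toReal)
    (Filter.Eventually.of_forall fun x => ENNReal.toReal_nonneg) hf.ennreal_toReal.aemeasurable
  simp only [ENNReal.ofReal_toReal (hfin _)] at e
  rw [e, ← lintegral_indicator measurableSet_Ioi, ← lintegral_indicator measurableSet_Ioo]
  congr 1 with t
  by_cases ht0 : 0 < t
  · have es : {x | t < (f x).toReal} = {x | ENNReal.ofReal t < f x} := by
      ext x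
      simp [ENNReal.ofReal_lt_iff_lt_toReal ht0.le (hfin x)]
    by_cases ht1 : t < 1
    · simp [Set.indicator, ht0, ht1, es]
    · have : {x | ENNReal.ofReal t < f x} = ∅ := by
        ext x
        simp only [Set.mem_ofPred_eq, Set.mem_empty_iff_false, iff_false, not_lt]
        exact (hf1 x).trans (by simpa using ht1)
      simp [Set.indicator, ht0, ht1, es, this]
  · simp [Set.indicator, ht0]

/-- Superlevel sets at height `t` combine into the superlevel set of `h`, so Brunn–Minkowski can be
integrated over `t`. It needs both sets nonempty, which the common supremum `1` ensures for every `t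
< 1`. The result is the arithmetic-mean form, stronger than the geometric one. -/
lemma prekopaLeindler_real_of_iSup_eq_one {θ : ℝ} (h0 : 0 < θ) (h1 : θ < 1) {f g h : ℝ → ℝ≥0∞}
    (hf : Measurable f) (hg : Measurable g) (hh : Measurable h) (sf : ⨆ x, f x = 1)
    (sg : ⨆ x, g x = 1) (H : ∀ x y, f x ^ θ * g y ^ (1 - θ) ≤ h (θ * x + (1 - θ) * y)) :
    ENNReal.ofReal θ * (∫⁻ x, f x) + ENNReal.ofReal (1 - θ) * (∫⁻ x, g x) ≤ ∫⁻ x, h x := by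
  have h1' : 0 < 1 - θ := by linarith
  have hf1 : ∀ x, f x ≤ 1 := fun x => sf ▸ le_iSup f x
  have hg1 : ∀ x, g x ≤ 1 := fun x => sg ▸ le_iSup g x
  have meas : ∀ u : ℝ → ℝ≥0∞, Measurable fun t : ℝ => volume {x | ENNReal.ofReal t < u x} :=
    fun u => Antitone.measurable fun s t hst => measure_mono fun x hx =>
      lt_of_le_of_lt (ENNReal.ofReal_le_ofReal hst) hx
  calc ENNReal.ofReal θ * (∫⁻ x, f x) + ENNReal.ofReal (1 - θ) * (∫⁻ x, g x)
      = ∫⁻ t in Set.Ioo (0 : ℝ) 1, (ENNReal.ofReal θ * volume {x | ENNReal.ofReal t < f x}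
          + ENNReal.ofReal (1 - θ) * volume {x | ENNReal.ofReal t < g x}) := by
        rw [lintegral_add_left ((meas f).const_mul _), lintegral_const_mul _ (meas f),
          lintegral_const_mul _ (meas g), ← lintegral_eq_setLIntegral_Ioo_meas_lt _ hf hf1,
          ← lintegral_eq_setLIntegral_Ioo_meas_lt _ hg hg1]
    _ ≤ ∫⁻ t in Set.Ioo (0 : ℝ) 1, volume {x | ENNReal.ofReal t < min (h x) 1} := by
        refine setLIntegral_mono (meas _) fun t ht => ?_
        have ht1 : ENNReal.ofReal t < 1 := by simpa using ht.2
        have ht0 : ENNReal.ofReal t ≠ 0 := by simpa using ht.1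
        refine volume_add_volume_le h0 h1 (measurableSet_lt measurable_const hf)
          (measurableSet_lt measurable_const hg) ?_ ?_ ?_
        · exact lt_iSup_iff.1 (sf.symm ▸ ht1)
        · exact lt_iSup_iff.1 (sg.symm ▸ ht1)
        · intro x hx y hy
          refine lt_min (lt_of_lt_of_le ?_ (H x y)) ht1
          calc ENNReal.ofReal t
              = ENNReal.ofReal t ^ θ * ENNReal.ofReal t ^ (1 - θ) := by
                rw [← ENNReal.rpow_add _ _ ht0 ENNReal.ofReal_ne_top]; simp
            _ < _ := ENNReal.mul_lt_mul (ENNReal.rpow_lt_rpow hx h0)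
                (ENNReal.rpow_lt_rpow hy h1')
    _ = ∫⁻ x, min (h x) 1 := (lintegral_eq_setLIntegral_Ioo_meas_lt _
        (hh.min measurable_const) fun x => min_le_right _ _).symm
    _ ≤ ∫⁻ x, h x := lintegral_mono fun x => min_le_left _ _

lemma ENNReal.rpow_mul_rpow_le_add {θ : ℝ} (h0 : 0 < θ) (h1 : θ < 1) (a b : ℝ≥0∞) :
    a ^ θ * b ^ (1 - θ) ≤ ENNReal.ofReal θ * a + ENNReal.ofReal (1 - θ) * b := by
  have h1' : 0 < 1 - θ := by linarith
  by_cases ha : a = ∞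
  · subst ha
    rw [ENNReal.mul_top (by simpa using h0)]
    simp
  by_cases hb : b = ∞
  · subst hb
    rw [ENNReal.mul_top (by simpa using h1)]
    simp
  lift a to NNReal using ha
  lift b to NNReal using hb
  have := NNReal.geom_mean_le_arith_mean2_weighted ⟨θ, h0.le⟩ ⟨1 - θ, h1'.le⟩ a b
    (NNReal.eq (by change θ + (1 - θ) = 1; ring))
  rw [← ENNReal.coe_rpow_of_nonneg _ h0.le, ← ENNReal.coe_rpow_of_nonneg _ h1'.le,
    ENNReal.ofReal_eq_coe_nnreal h0.le, ENNReal.ofReal_eq_coe_nnreal h1'.le]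
  exact_mod_cast this

/-- The geometric-mean form is homogeneous in `f` and `g` separately, so both may be divided by
their suprema; AM–GM then weakens the normalised inequality. -/
lemma prekopaLeindler_real_of_iSup_ne_top {θ : ℝ} (h0 : 0 < θ) (h1 : θ < 1) {f g h : ℝ → ℝ≥0∞}
    (hf : Measurable f) (hg : Measurable g) (hh : Measurable h) (sf : ⨆ x, f x ≠ ∞)
    (sg : ⨆ x, g x ≠ ∞) (H : ∀ x y, f x ^ θ * g y ^ (1 - θ) ≤ h (θ * x + (1 - θ) * y)) :
    (∫⁻ x, f x) ^ θ * (∫⁻ x, g x) ^ (1 - θ) ≤ ∫⁻ x, h x := by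
  have h1' : 0 < 1 - θ := by linarith
  set a := ⨆ x, f x
  set b := ⨆ x, g x
  by_cases ha : a = 0
  · have : ∀ x, f x = 0 := fun x => le_antisymm (ha ▸ le_iSup f x) bot_le
    simp [this, ENNReal.zero_rpow_of_pos h0]
  by_cases hb : b = 0
  · have : ∀ x, g x = 0 := fun x => le_antisymm (hb ▸ le_iSup g x) bot_le
    simp [this, ENNReal.zero_rpow_of_pos h1']
  set c := a ^ θ * b ^ (1 - θ) with hc
  have hc0 : c ≠ 0 := by
    simp [hc, ENNReal.rpow_eq_zero_iff, ha, hb, h0.not_gt, h1.not_gt]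
  have hct : c ≠ ∞ := ENNReal.mul_ne_top (ENNReal.rpow_ne_top_of_nonneg h0.le sf)
    (ENNReal.rpow_ne_top_of_nonneg h1'.le sg)
  have e : ∀ u v : ℝ≥0∞, (a⁻¹ * u) ^ θ * (b⁻¹ * v) ^ (1 - θ) = c⁻¹ * (u ^ θ * v ^ (1 - θ)) := by
    intro u v
    rw [ENNReal.mul_rpow_of_nonneg _ _ h0.le, ENNReal.mul_rpow_of_nonneg _ _ h1'.le, hc,
      ENNReal.mul_inv (Or.inr (ENNReal.rpow_ne_top_of_nonneg h1'.le sg))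
        (Or.inl (ENNReal.rpow_ne_top_of_nonneg h0.le sf)), ENNReal.inv_rpow, ENNReal.inv_rpow]
    ring
  have key := prekopaLeindler_real_of_iSup_eq_one h0 h1 (f := fun x => a⁻¹ * f x)
    (g := fun x => b⁻¹ * g x) (h := fun x => c⁻¹ * h x) (hf.const_mul _) (hg.const_mul _)
    (hh.const_mul _) (by rw [← ENNReal.mul_iSup, ENNReal.inv_mul_cancel ha sf])
    (by rw [← ENNReal.mul_iSup, ENNReal.inv_mul_cancel hb sg])
    (fun x y => by rw [e]; gcongr; exact H x y)
  have := (ENNReal.rpow_mul_rpow_le_add h0 h1 _ _).trans key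
  rw [lintegral_const_mul _ hf, lintegral_const_mul _ hg, lintegral_const_mul _ hh, e] at this
  exact (ENNReal.mul_le_mul_iff_right (ENNReal.inv_ne_zero.2 hct) (ENNReal.inv_ne_top.2 hc0)).1 this

lemma tendsto_lintegral_min_natCast {α : Type*} [MeasurableSpace α] (μ : Measure α)
    {f : α → ℝ≥0∞} (hf : Measurable f) :
    Filter.Tendsto (fun N : ℕ => ∫⁻ x, min (f x) N ∂μ) Filter.atTop (nhds (∫⁻ x, f x ∂μ)) := by
  refine lintegral_tendsto_of_tendsto_of_monotone
    (fun N => (hf.min measurable_const).aemeasurable) ?_ ?_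
  · exact Filter.Eventually.of_forall fun x m n hmn => min_le_min le_rfl (by exact_mod_cast hmn)
  · refine Filter.Eventually.of_forall fun x => ?_
    have := (tendsto_const_nhds (x := f x)).min ENNReal.tendsto_nat_nhds_top
    simpa using this

/-- The Prékopa–Leindler inequality on the real line. -/
theorem prekopaLeindler_real : PrekopaLeindler (volume : Measure ℝ) := by
  intro θ h0 h1 f g h hf hg hh H
  have h1' : 0 < 1 - θ := by linarith
  -- Vanishing integrals are set aside because the product of the truncated integrals need not
  -- converge at `0 · ∞`.
  by_cases hf0 : ∫⁻ x, f x = 0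
  · simp [hf0, ENNReal.zero_rpow_of_pos h0]
  by_cases hg0 : ∫⁻ x, g x = 0
  · simp [hg0, ENNReal.zero_rpow_of_pos h1']
  have lim := ENNReal.Tendsto.mul
    ((tendsto_lintegral_min_natCast volume hf).ennrpow_const θ)
    (Or.inl (by simp [ENNReal.rpow_eq_zero_iff, hf0, h0.not_gt]))
    ((tendsto_lintegral_min_natCast volume hg).ennrpow_const (1 - θ))
    (Or.inl (by simp [ENNReal.rpow_eq_zero_iff, hg0, h1.not_gt]))
  refine le_of_tendsto' lim fun N => ?_
  have bd : ∀ u : ℝ → ℝ≥0∞, ⨆ x, min (u x) N ≠ ∞ := fun u =>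
    ne_top_of_le_ne_top (ENNReal.natCast_ne_top N) (iSup_le fun x => min_le_right _ _)
  refine prekopaLeindler_real_of_iSup_ne_top h0 h1 (hf.min measurable_const)
    (hg.min measurable_const) hh (bd f) (bd g) fun x y => le_trans ?_ (H x y)
  gcongr
  · exact min_le_left _ _
  · exact min_le_left _ _

/-- For fixed first coordinates the inequality on fibres is exactly the hypothesis needed to apply
the inequality to the fibre integrals. -/
theorem PrekopaLeindler.prod {E F : Type*} [AddCommGroup E] [Module ℝ E] [MeasurableSpace E]
    [AddCommGroup F] [Module ℝ F] [MeasurableSpace F] {μ : Measure E} {ν : Measure F}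
    [SFinite μ] [SFinite ν] (hμ : PrekopaLeindler μ) (hν : PrekopaLeindler ν) :
    PrekopaLeindler (μ.prod ν) := by
  intro θ h0 h1 f g h hf hg hh H
  rw [lintegral_prod _ hf.aemeasurable, lintegral_prod _ hg.aemeasurable,
    lintegral_prod _ hh.aemeasurable]
  refine hμ h0 h1 hf.lintegral_prod_right' hg.lintegral_prod_right' hh.lintegral_prod_right' ?_
  intro x y
  exact hν h0 h1 (hf.comp measurable_prodMk_left) (hg.comp measurable_prodMk_left)
    (hh.comp measurable_prodMk_left) fun u v => H (x, u) (y, v)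

theorem PrekopaLeindler.of_measurePreserving {E F : Type*} [AddCommGroup E] [Module ℝ E]
    [MeasurableSpace E] [AddCommGroup F] [Module ℝ F] [MeasurableSpace F] {μ : Measure E}
    {ν : Measure F} (hμ : PrekopaLeindler μ) (e : E →ₗ[ℝ] F) (he : MeasurePreserving e μ ν) :
    PrekopaLeindler ν := by
  intro θ h0 h1 f g h hf hg hh H
  rw [← he.lintegral_comp hf, ← he.lintegral_comp hg, ← he.lintegral_comp hh]
  refine hμ h0 h1 (hf.comp he.measurable) (hg.comp he.measurable) (hh.comp he.measurable) ?_
  intro x y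
  simpa using H (e x) (e y)

theorem prekopaLeindler_pi (n : ℕ) : PrekopaLeindler (volume : Measure (Fin n → ℝ)) := by
  induction n with
  | zero =>
    intro θ h0 h1 f g h hf hg hh H
    have : (volume : Measure (Fin 0 → ℝ)) = Measure.dirac 0 := by
      rw [volume_pi, Measure.pi_of_empty _ 0]
    simpa [this] using H 0 0
  | succ n ih =>
    refine (prekopaLeindler_real.prod ih).of_measurePreserving
      (Fin.consLinearEquiv ℝ (fun _ : Fin (n + 1) => ℝ)).toLinearMap ?_
    have e : ⇑(Fin.consLinearEquiv ℝ (fun _ : Fin (n + 1) => ℝ)).toLinearMap =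
        ⇑(MeasurableEquiv.piFinSuccAbove (fun _ : Fin (n + 1) => ℝ) 0).symm := by
      ext x i
      simp [MeasurableEquiv.piFinSuccAbove, Fin.consLinearEquiv]
    rw [e]
    exact (volume_preserving_piFinSuccAbove (fun _ : Fin (n + 1) => ℝ) 0).symm

theorem prekopaLeindler_euclideanSpace (n : ℕ) :
    PrekopaLeindler (volume : Measure (EuclideanSpace ℝ (Fin n))) :=
  (prekopaLeindler_pi n).of_measurePreserving
    (WithLp.linearEquiv 2 ℝ (Fin n → ℝ)).symm.toLinearMap (PiLp.volume_preserving_toLp (Fin n))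

/-! ### Log-concave measures on the line and marginals. -/

/-- A measure on the line is log-concave if `ν(θ A + (1 - θ) B) ≥ ν(A) ^ θ ν(B) ^ (1 - θ)`. -/
def IsLogConcaveMeasure (ν : Measure ℝ) : Prop :=
  ∀ ⦃θ : ℝ⦄, 0 < θ → θ < 1 → ∀ ⦃A B C : Set ℝ⦄, MeasurableSet A → MeasurableSet B →
    MeasurableSet C → (∀ x ∈ A, ∀ y ∈ B, θ * x + (1 - θ) * y ∈ C) →
    ν A ^ θ * ν B ^ (1 - θ) ≤ ν C

lemma IsLogConcaveMeasure.real {ν : Measure ℝ} [IsFiniteMeasure ν] (hν : IsLogConcaveMeasure ν)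
    {θ : ℝ} (h0 : 0 < θ) (h1 : θ < 1) {A B C : Set ℝ} (hA : MeasurableSet A)
    (hB : MeasurableSet B) (hC : MeasurableSet C)
    (h : ∀ x ∈ A, ∀ y ∈ B, θ * x + (1 - θ) * y ∈ C) :
    ν.real A ^ θ * ν.real B ^ (1 - θ) ≤ ν.real C := by
  have := ENNReal.toReal_mono (measure_ne_top ν C) (hν h0 h1 hA hB hC h)
  simpa [Measure.real, ENNReal.toReal_mul, ENNReal.toReal_rpow] using this

lemma IsLogConcaveMeasure.map_neg {ν : Measure ℝ} (hν : IsLogConcaveMeasure ν) :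
    IsLogConcaveMeasure (ν.map Neg.neg) := by
  intro θ h0 h1 A B C hA hB hC h
  rw [Measure.map_apply measurable_neg hA, Measure.map_apply measurable_neg hB,
    Measure.map_apply measurable_neg hC]
  refine hν h0 h1 (measurable_neg hA) (measurable_neg hB) (measurable_neg hC) ?_
  intro x hx y hy
  have := h _ hx _ hy
  simp only [Set.mem_preimage]
  convert this using 1
  ring

/-- One-dimensional marginals of log-concave densities are log-concave. -/
theorem IsLogConcaveFun.isLogConcaveMeasure_map {n : ℕ} {f : EuclideanSpace ℝ (Fin n) → ℝ}
    (hfm : Measurable f) (hf : IsLogConcaveFun f) (φ : EuclideanSpace ℝ (Fin n) →L[ℝ] ℝ) :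
    IsLogConcaveMeasure
      (((volume : Measure (EuclideanSpace ℝ (Fin n))).withDensity
        (fun x => ENNReal.ofReal (f x))).map φ) := by
  intro θ h0 h1 A B C hA hB hC h
  have h1' : 0 < 1 - θ := by linarith
  have hφ : Measurable φ := φ.continuous.measurable
  have e : ∀ S : Set ℝ, MeasurableSet S →
      (((volume : Measure (EuclideanSpace ℝ (Fin n))).withDensity
        (fun x => ENNReal.ofReal (f x))).map φ) S =
      ∫⁻ x, (φ ⁻¹' S).indicator (fun x => ENNReal.ofReal (f x)) x := fun S hS => by
    rw [Measure.map_apply hφ hS, withDensity_apply _ (hφ hS), lintegral_indicator (hφ hS)]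
  rw [e A hA, e B hB, e C hC]
  refine prekopaLeindler_euclideanSpace n h0 h1 (hfm.ennreal_ofReal.indicator (hφ hA))
    (hfm.ennreal_ofReal.indicator (hφ hB)) (hfm.ennreal_ofReal.indicator (hφ hC)) fun x y => ?_
  by_cases hx : φ x ∈ A
  swap
  · simp [Set.indicator, hx, ENNReal.zero_rpow_of_pos h0]
  by_cases hy : φ y ∈ B
  swap
  · simp [Set.indicator, hy, ENNReal.zero_rpow_of_pos h1']
  have hxy : φ (θ • x + (1 - θ) • y) ∈ C := by simpa using h _ hx _ hy
  rw [Set.indicator_of_mem (by exact hx), Set.indicator_of_mem (by exact hy),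
    Set.indicator_of_mem (by exact hxy)]
  -- Log-concavity is only assumed on the support, so zeros of `f` are treated apart.
  by_cases hfx : f x = 0
  · simp [hfx, ENNReal.zero_rpow_of_pos h0]
  by_cases hfy : f y = 0
  · simp [hfy, ENNReal.zero_rpow_of_pos h1']
  rw [ENNReal.ofReal_rpow_of_nonneg (hf.1 x) h0.le, ENNReal.ofReal_rpow_of_nonneg (hf.1 y) h1'.le,
    ← ENNReal.ofReal_mul (Real.rpow_nonneg (hf.1 x) _)]
  exact ENNReal.ofReal_le_ofReal (hf.2 x hfx y hfy θ h0 h1)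

/-! ### Small ball estimate on the line. -/

section SmallBall

variable {ν : Measure ℝ} [IsProbabilityMeasure ν]

lemma measurableSet_lt_abs (s : ℝ) : MeasurableSet {x : ℝ | s < |x|} :=
  measurableSet_lt measurable_const measurable_norm

/-- The midpoint of a point beyond `3 s` in absolute value and a point of `[-s, s]` is beyond `s`;
this is log-concavity at `θ = 1 / 2`, squared. -/
lemma IsLogConcaveMeasure.tail_three_mul (hν : IsLogConcaveMeasure ν) (s : ℝ) :
    ν.real {x | 3 * s < |x|} * (1 - ν.real {x | s < |x|}) ≤ ν.real {x | s < |x|} ^ 2 := by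
  have h := hν.real (θ := 1 / 2) (by norm_num) (by norm_num) (measurableSet_lt_abs (3 * s))
    (measurableSet_lt_abs s).compl (measurableSet_lt_abs s) (fun x hx y hy => by
      simp only [Set.mem_ofPred_eq, Set.mem_compl_iff, not_lt] at hx hy ⊢
      have h1 : |x| ≤ |x + y| + |y| := by simpa using abs_sub (x + y) y
      have h2 : 1 / 2 * x + (1 - 1 / 2) * y = (1 / 2) * (x + y) := by ring
      rw [h2, abs_mul, abs_of_pos (by norm_num : (0 : ℝ) < 1 / 2)]
      linarith)
  rw [show (1 : ℝ) - 1 / 2 = 1 / 2 by norm_num, ← Real.sqrt_eq_rpow, ← Real.sqrt_eq_rpow,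
    ← Real.sqrt_mul measureReal_nonneg, Real.sqrt_le_left measureReal_nonneg,
    probReal_compl_eq_one_sub (measurableSet_lt_abs s)] at h
  exact h

/-- If `a ≤ 1 / 20` then `a ^ 2 / (1 - a) ≤ a / 19`. The ratio `1 / 19` beats the growth `9` of `x ^
2` under tripling. -/
lemma IsLogConcaveMeasure.tail_geometric (hν : IsLogConcaveMeasure ν) {s : ℝ}
    (h : ν.real {x | s < |x|} ≤ 1 / 20) (k : ℕ) :
    ν.real {x | 3 ^ k * s < |x|} ≤ 1 / 20 * (1 / 19) ^ k := by
  induction k with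
  | zero => simpa using h
  | succ k ih =>
    have h1 := hν.tail_three_mul (3 ^ k * s)
    rw [← mul_assoc, ← pow_succ'] at h1
    set a := ν.real {x | 3 ^ k * s < |x|}
    set b := ν.real {x | 3 ^ (k + 1) * s < |x|}
    have ha : 0 ≤ a := measureReal_nonneg
    have hb : 0 ≤ b := measureReal_nonneg
    have hp : (1 / 19 : ℝ) ^ k ≤ 1 := pow_le_one₀ (by norm_num) (by norm_num)
    have ha' : a ≤ 1 / 20 := by linarith
    have : b ≤ a / 19 := by nlinarith
    rw [pow_succ]
    linarith

/-- Triadic layers: the increments `8 * 9 ^ k * s ^ 2` telescope to `9 ^ j * s ^ 2`, which dominates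
`x ^ 2` at the first `j` with `|x| ≤ 3 ^ j * s`. -/
lemma ofReal_sq_le_tsum {s : ℝ} (hs : 0 < s) (x : ℝ) :
    ENNReal.ofReal (x ^ 2) ≤ ENNReal.ofReal (s ^ 2) +
      ∑' k : ℕ, {x : ℝ | 3 ^ k * s < |x|}.indicator
        (fun _ => ENNReal.ofReal (8 * 9 ^ k * s ^ 2)) x := by
  have hex : ∃ m : ℕ, |x| ≤ 3 ^ m * s := by
    obtain ⟨m, hm⟩ := pow_unbounded_of_one_lt (|x| / s) (by norm_num : (1 : ℝ) < 3)
    exact ⟨m, ((div_lt_iff₀ hs).1 hm).le⟩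
  classical
  let m₀ := Nat.find hex
  have hm₀ : |x| ≤ 3 ^ m₀ * s := Nat.find_spec hex
  have hlt : ∀ k < m₀, 3 ^ k * s < |x| := fun k hk => not_le.1 (Nat.find_min hex hk)
  have geom : ∀ j : ℕ, s ^ 2 + ∑ k ∈ Finset.range j, 8 * 9 ^ k * s ^ 2 = 9 ^ j * s ^ 2 := by
    intro j
    induction j with
    | zero => simp
    | succ j ih => rw [Finset.sum_range_succ, ← add_assoc, ih, pow_succ]; ring
  calc ENNReal.ofReal (x ^ 2) ≤ ENNReal.ofReal (9 ^ m₀ * s ^ 2) := by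
        refine ENNReal.ofReal_le_ofReal ?_
        rw [← sq_abs]
        calc |x| ^ 2 ≤ (3 ^ m₀ * s) ^ 2 := by gcongr
          _ = 9 ^ m₀ * s ^ 2 := by
            rw [mul_pow, ← pow_mul, mul_comm m₀ 2, pow_mul]; norm_num
    _ = ENNReal.ofReal (s ^ 2) + ∑ k ∈ Finset.range m₀, ENNReal.ofReal (8 * 9 ^ k * s ^ 2) := by
        rw [← geom, ENNReal.ofReal_add (by positivity) (Finset.sum_nonneg fun _ _ => by positivity),
          ENNReal.ofReal_sum_of_nonneg fun _ _ => by positivity]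
    _ = ENNReal.ofReal (s ^ 2) + ∑ k ∈ Finset.range m₀, {x : ℝ | 3 ^ k * s < |x|}.indicator
        (fun _ => ENNReal.ofReal (8 * 9 ^ k * s ^ 2)) x := by
        congr 1
        refine Finset.sum_congr rfl fun k hk => ?_
        rw [Set.indicator_of_mem]
        exact hlt k (Finset.mem_range.1 hk)
    _ ≤ _ := by gcongr; exact ENNReal.sum_le_tsum _

/-- Otherwise geometric tails would force a second moment of at most `1 / 4 + (1 / 10) / (1 - 9 /
19) = 0.44`. -/
lemma IsLogConcaveMeasure.tail_half (hν : IsLogConcaveMeasure ν)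
    (h2 : ∫⁻ x, ENNReal.ofReal (x ^ 2) ∂ν = 1) : 1 / 20 < ν.real {x | 1 / 2 < |x|} := by
  by_contra! hc
  have hs : (0 : ℝ) < 1 / 2 := by norm_num
  have key : ∫⁻ x, ENNReal.ofReal (x ^ 2) ∂ν ≤ ENNReal.ofReal (44 / 100) := by
    calc ∫⁻ x, ENNReal.ofReal (x ^ 2) ∂ν
        ≤ ∫⁻ x, (ENNReal.ofReal ((1 / 2) ^ 2) + ∑' k : ℕ, {x : ℝ | 3 ^ k * (1 / 2) < |x|}.indicator
          (fun _ => ENNReal.ofReal (8 * 9 ^ k * (1 / 2) ^ 2)) x) ∂ν :=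
          lintegral_mono fun x => ofReal_sq_le_tsum hs x
      _ = ENNReal.ofReal ((1 / 2) ^ 2) + ∑' k : ℕ,
          ENNReal.ofReal (8 * 9 ^ k * (1 / 2) ^ 2) * ν {x : ℝ | 3 ^ k * (1 / 2) < |x|} := by
          rw [lintegral_add_left measurable_const, lintegral_const, measure_univ, mul_one,
            lintegral_tsum fun k => (measurable_const.indicator
              (measurableSet_lt_abs _)).aemeasurable]
          congr 2 with k
          rw [lintegral_indicator_const (measurableSet_lt_abs _)]
      _ ≤ ENNReal.ofReal ((1 / 2) ^ 2) + ∑' k : ℕ, ENNReal.ofReal (1 / 10 * (9 / 19) ^ k) := by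
          gcongr with k
          rw [← ofReal_measureReal, ← ENNReal.ofReal_mul (by positivity)]
          refine ENNReal.ofReal_le_ofReal ?_
          calc 8 * 9 ^ k * (1 / 2) ^ 2 * ν.real {x : ℝ | 3 ^ k * (1 / 2) < |x|}
              ≤ 8 * 9 ^ k * (1 / 2) ^ 2 * (1 / 20 * (1 / 19) ^ k) := by
                gcongr; exact hν.tail_geometric hc k
            _ = 1 / 10 * (9 / 19) ^ k := by
              rw [show (9 / 19 : ℝ) = 9 * (1 / 19) by norm_num, mul_pow]; ring
      _ = ENNReal.ofReal (44 / 100) := by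
          have hsum : HasSum (fun k : ℕ => (1 / 10 : ℝ) * (9 / 19) ^ k)
              (1 / 10 * (1 - 9 / 19)⁻¹) :=
            (hasSum_geometric_of_lt_one (by norm_num) (by norm_num)).mul_left _
          rw [← ENNReal.ofReal_tsum_of_nonneg (fun k => by positivity) hsum.summable, hsum.tsum_eq,
            ← ENNReal.ofReal_add (by positivity) (by norm_num)]
          norm_num
  rw [h2] at key
  have : ENNReal.ofReal (44 / 100) < 1 := by
    rw [ENNReal.ofReal_lt_one]; norm_num
  exact absurd key (not_le.2 this)

lemma measureReal_lt_abs_le (h2 : ∫⁻ x, ENNReal.ofReal (x ^ 2) ∂ν = 1) {b : ℝ} (hb : 0 < b) :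
    ν.real {x | b < |x|} ≤ 1 / b ^ 2 := by
  have h := mul_meas_ge_le_lintegral₀ (μ := ν) (f := fun x : ℝ => ENNReal.ofReal (x ^ 2))
    (by fun_prop) (ENNReal.ofReal (b ^ 2))
  rw [h2] at h
  have hsub : ν {x | b < |x|} ≤ ν {x | ENNReal.ofReal (b ^ 2) ≤ ENNReal.ofReal (x ^ 2)} := by
    refine measure_mono fun x hx => ENNReal.ofReal_le_ofReal ?_
    rw [← sq_abs x]
    have : b < |x| := hx
    gcongr
  have h' := (mul_le_mul_right hsub (ENNReal.ofReal (b ^ 2))).trans h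
  rw [← ofReal_measureReal, ← ENNReal.ofReal_mul (by positivity), ENNReal.ofReal_le_one] at h'
  rw [le_div_iff₀ (by positivity)]
  linarith

/-- Pigeonhole: `⌈7 / (2 t)⌉ ≤ 4 / t` windows of length `2 t` cover the interval. -/
lemma measureReal_le_of_forall_Ioc_le {t q : ℝ} (ht : 0 < t) (ht' : t ≤ 1 / 16) (hq : 0 ≤ q)
    (h : ∀ c : ℝ, 7 / 16 ≤ c → ν.real (Set.Ioc (c - t) (c + t)) ≤ q) :
    ν.real (Set.Ioc (1 / 2) 7) ≤ 4 / t * q := by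
  set N := ⌈7 / (2 * t)⌉₊
  have hN : (7 : ℝ) ≤ 2 * t * N := by
    have := Nat.le_ceil (7 / (2 * t))
    rw [div_le_iff₀ (by positivity)] at this
    linarith
  have hN' : (N : ℝ) ≤ 4 / t := by
    have h1 : (N : ℝ) < 7 / (2 * t) + 1 := Nat.ceil_lt_add_one (by positivity)
    have h2 : 4 / t - 7 / (2 * t) = 1 / (2 * t) := by field_simp; norm_num
    have h3 : 1 ≤ 1 / (2 * t) := by rw [le_div_iff₀ (by positivity)]; linarith
    linarith
  have hsub : Set.Ioc (1 / 2 : ℝ) 7 ⊆ ⋃ i ∈ Finset.range N,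
      (Set.Ioc (1 / 2 + (2 * i : ℝ) * t) (1 / 2 + (2 * i + 2 : ℝ) * t)) := by
    rintro x ⟨hx1, hx2⟩
    set m := ⌈(x - 1 / 2) / (2 * t)⌉₊
    have hm0 : 0 < m := Nat.ceil_pos.2 (by apply div_pos <;> linarith)
    have hm1 : x - 1 / 2 ≤ 2 * t * m := by
      have := Nat.le_ceil ((x - 1 / 2) / (2 * t))
      rw [div_le_iff₀ (by positivity)] at this
      linarith
    have hm2 : 2 * t * (m - 1) < x - 1 / 2 := by
      have := Nat.ceil_lt_add_one (a := (x - 1 / 2) / (2 * t)) (by apply div_nonneg <;> linarith)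
      have h' : (m : ℝ) - 1 < (x - 1 / 2) / (2 * t) := by linarith
      rw [lt_div_iff₀ (by positivity)] at h'
      linarith
    obtain ⟨j, hj⟩ : ∃ j, m = j + 1 := ⟨m - 1, by omega⟩
    rw [hj] at hm1 hm2
    push_cast at hm1 hm2
    simp only [Set.mem_iUnion, Finset.mem_range, Set.mem_Ioc, exists_prop]
    refine ⟨j, ?_, by linarith, by linarith⟩
    have : 2 * t * (j : ℝ) < 2 * t * N := by linarith
    exact_mod_cast lt_of_mul_lt_mul_left this (by positivity)
  calc ν.real (Set.Ioc (1 / 2) 7)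
      ≤ ∑ i ∈ Finset.range N,
        ν.real (Set.Ioc (1 / 2 + (2 * i : ℝ) * t) (1 / 2 + (2 * i + 2 : ℝ) * t)) :=
        (measureReal_mono hsub (measure_ne_top _ _)).trans (measureReal_biUnion_finset_le _ _)
    _ ≤ ∑ i ∈ Finset.range N, q := by
        refine Finset.sum_le_sum fun i _ => ?_
        have := h (1 / 2 + (2 * i + 1) * t) (by nlinarith [(Nat.cast_nonneg i : (0 : ℝ) ≤ i)])
        rwa [show 1 / 2 + (2 * i + 1) * t - t = 1 / 2 + (2 * i : ℝ) * t by ring,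
          show 1 / 2 + (2 * i + 1) * t + t = 1 / 2 + (2 * i + 2 : ℝ) * t by ring] at this
    _ = N * q := by simp
    _ ≤ 4 / t * q := by gcongr

lemma sum_measureReal_Ioc_le_one {t : ℝ} (M : ℕ) :
    ∑ i ∈ Finset.Icc 1 M, ν.real (Set.Ioc (2 * t * i - t) (2 * t * i + t)) ≤ 1 := by
  rcases le_or_gt t 0 with ht | ht
  · refine (Finset.sum_nonpos fun i _ => ?_).trans zero_le_one
    rw [Set.Ioc_eq_empty (by linarith)]
    simp
  rw [← measureReal_biUnion_finset _ fun i _ => measurableSet_Ioc]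
  · exact measureReal_le_one
  · intro i _ j _ hij
    rw [Function.onFun, Set.disjoint_left]
    rintro x ⟨h1, h2⟩ ⟨h3, h4⟩
    apply hij
    have key : ∀ a b : ℕ, 2 * t * a - t < x → x ≤ 2 * t * b + t → a ≤ b := by
      intro a b ha hb
      have : t * (a : ℝ) < t * (b + 1 : ℕ) := by push_cast; linarith
      have := lt_of_mul_lt_mul_left this ht.le
      have : a < b + 1 := by exact_mod_cast this
      omega
    exact le_antisymm (key i j h1 h4) (key j i h3 h2)

/-- If the window at `0` were too heavy, interpolating it with a moderately heavy window at some `c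
≥ 7 / 16` would make every window centred between `0` and `c / 2` heavy. Disjoint such windows would
then carry total mass above `1`. -/
lemma IsLogConcaveMeasure.smallBall_of_right (hν : IsLogConcaveMeasure ν)
    (hr : 1 / 80 < ν.real (Set.Ioc (1 / 2) 7)) {t : ℝ} (ht : 0 < t) :
    ν.real (Set.Ioc (-t) t) ≤ 327680 * t := by
  by_contra! hc
  have hp1 : ν.real (Set.Ioc (-t) t) ≤ 1 := measureReal_le_one
  have ht' : t ≤ 1 / 16 := by linarith
  obtain ⟨c, hc1, hc2⟩ : ∃ c : ℝ, 7 / 16 ≤ c ∧ t / 320 < ν.real (Set.Ioc (c - t) (c + t)) := by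
    by_contra! h
    have := measureReal_le_of_forall_Ioc_le ht ht' (by positivity) h
    have e : 4 / t * (t / 320) = 1 / 80 := by field_simp; norm_num
    linarith
  have hcpos : 0 < c := by linarith
  -- The centres `2 t i` with `i ≤ M` stay below `c / 2`, so the interpolation weight `l` is at most
  -- `1 / 2`.
  set M := ⌊c / (4 * t)⌋₊
  have hM : 1 / (32 * t) ≤ M := by
    have h1 : c / (4 * t) < M + 1 := Nat.lt_floor_add_one _
    rw [div_lt_iff₀ (by positivity)] at h1
    rw [div_le_iff₀ (by positivity)]
    linarith
  have hM' : 4 * t * M ≤ c := by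
    have h1 : (M : ℝ) ≤ c / (4 * t) := Nat.floor_le (by positivity)
    rw [le_div_iff₀ (by positivity)] at h1
    linarith
  set p := ν.real (Set.Ioc (-t) t)
  have hlow : ∀ i ∈ Finset.Icc 1 M,
      32 * t < ν.real (Set.Ioc (2 * t * i - t) (2 * t * i + t)) := by
    intro i hi
    rw [Finset.mem_Icc] at hi
    have hi1 : (1 : ℝ) ≤ i := by exact_mod_cast hi.1
    have hi2 : (i : ℝ) ≤ M := by exact_mod_cast hi.2
    set l := 2 * t * i / c
    have hl0 : 0 < l := by positivity
    have hl2 : l ≤ 1 / 2 := by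
      rw [div_le_iff₀ hcpos]
      nlinarith
    have hlc : l * c = 2 * t * i := by simp only [l]; field_simp
    have h := hν.real (θ := l) hl0 (by linarith) measurableSet_Ioc measurableSet_Ioc
      measurableSet_Ioc (A := Set.Ioc (c - t) (c + t)) (B := Set.Ioc (-t) t)
      (C := Set.Ioc (2 * t * i - t) (2 * t * i + t)) (by
        rintro x ⟨hx1, hx2⟩ y ⟨hy1, hy2⟩
        have a1 := mul_lt_mul_of_pos_left hx1 hl0
        have a2 := mul_le_mul_of_nonneg_left hx2 hl0.le
        have a3 := mul_lt_mul_of_pos_left hy1 (by linarith : 0 < 1 - l)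
        have a4 := mul_le_mul_of_nonneg_left hy2 (by linarith : 0 ≤ 1 - l)
        constructor <;> linarith)
    refine lt_of_lt_of_le ?_ h
    have b1 : (t / 320) ^ l * (327680 * t) ^ (1 - l) <
        ν.real (Set.Ioc (c - t) (c + t)) ^ l * p ^ (1 - l) :=
      mul_lt_mul'' (Real.rpow_lt_rpow (by positivity) hc2 hl0)
        (Real.rpow_lt_rpow (by positivity) hc (by linarith)) (by positivity) (by positivity)
    refine lt_of_le_of_lt ?_ b1
    -- The constant satisfies `327680 = 10240 ^ 2 / 320`, so at the worst weight `l = 1 / 2` the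
    -- mean is `32 t`, matching `M ≥ 1 / (32 t)`.
    have e : (t / 320) ^ l * (327680 * t) ^ (1 - l) = 327680 * t * (10240 ^ 2 : ℝ) ^ (-l) := by
      rw [Real.rpow_sub (by positivity), Real.rpow_one, Real.rpow_neg (by positivity),
        show 327680 * t = t / 320 * 10240 ^ 2 by ring, Real.mul_rpow (by positivity) (by positivity)]
      field_simp
    rw [e]
    have : (10240 ^ 2 : ℝ) ^ (-(1 / 2) : ℝ) ≤ (10240 ^ 2 : ℝ) ^ (-l) :=
      Real.rpow_le_rpow_of_exponent_le (by norm_num) (by linarith)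
    rw [Real.rpow_neg (by positivity), ← Real.sqrt_eq_rpow, Real.sqrt_sq (by norm_num)] at this
    calc 32 * t = 327680 * t * (10240)⁻¹ := by ring
      _ ≤ _ := by gcongr
  have hM0 : (Finset.Icc 1 M).Nonempty := by
    rw [Finset.nonempty_Icc]
    have : (0 : ℝ) < M := lt_of_lt_of_le (by positivity) hM
    exact_mod_cast this
  have hlt := Finset.sum_lt_sum_of_nonempty hM0 hlow
  have := sum_measureReal_Ioc_le_one (ν := ν) (t := t) M
  rw [Finset.sum_const, Nat.card_Icc, Nat.add_sub_cancel, nsmul_eq_mul] at hlt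
  rw [div_le_iff₀ (by positivity)] at hM
  linarith

/-- Small ball estimate at the origin for log-concave laws on the line with unit second moment. -/
theorem IsLogConcaveMeasure.smallBall (hν : IsLogConcaveMeasure ν)
    (h2 : ∫⁻ x, ENNReal.ofReal (x ^ 2) ∂ν = 1) {t : ℝ} (ht : 0 ≤ t) :
    ν.real {x | |x| ≤ t} ≤ 655360 * t := by
  have pos : ∀ t : ℝ, 0 < t → ν.real {x | |x| ≤ t} ≤ 655360 * t := by
    intro t ht
    -- Since `1 / 20 - 1 / 49 > 2 / 80`, one of the two sides `1 / 2 < ± x ≤ 7` has mass above `1 /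
    -- 80`; a reflection puts it on the right.
    have hb := measureReal_lt_abs_le h2 (by norm_num : (0 : ℝ) < 7)
    have hs := hν.tail_half h2
    have hsub : {x : ℝ | 1 / 2 < |x|} ⊆
        {x | 7 < |x|} ∪ (Set.Ioc (1 / 2) 7 ∪ Neg.neg ⁻¹' Set.Ioc (1 / 2) 7) := by
      intro x hx
      simp only [Set.mem_ofPred_eq, Set.mem_union, Set.mem_Ioc, Set.mem_preimage] at hx ⊢
      rcases le_or_gt |x| 7 with h7 | h7
      · right
        rcases abs_cases x with ⟨h, _⟩ | ⟨h, _⟩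
        · left; rw [h] at hx h7; exact ⟨hx, h7⟩
        · right; rw [h] at hx h7; exact ⟨hx, h7⟩
      · exact Or.inl h7
    have h3 := (measureReal_mono (μ := ν) hsub).trans ((measureReal_union_le _ _).trans
      (add_le_add le_rfl (measureReal_union_le _ _)))
    rcases lt_or_ge (1 / 80) (ν.real (Set.Ioc (1 / 2) 7)) with h | h
    -- Doubling `t` fits the closed interval into a half-open one, which doubles the constant.
    · have hsub' : {x : ℝ | |x| ≤ t} ⊆ Set.Ioc (-(2 * t)) (2 * t) := by
        intro x hx
        have := abs_le.1 (show |x| ≤ t from hx)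
        constructor <;> linarith
      have := hν.smallBall_of_right h (t := 2 * t) (by linarith)
      linarith [measureReal_mono (μ := ν) hsub']
    · have : IsProbabilityMeasure (ν.map Neg.neg) :=
        Measure.isProbabilityMeasure_map measurable_neg.aemeasurable
      have h' : 1 / 80 < (ν.map Neg.neg).real (Set.Ioc (1 / 2) 7) := by
        rw [map_measureReal_apply measurable_neg measurableSet_Ioc]
        norm_num at hb
        linarith
      have hsub' : {x : ℝ | |x| ≤ t} ⊆ Neg.neg ⁻¹' Set.Ioc (-(2 * t)) (2 * t) := by
        intro x hx
        have := abs_le.1 (show |x| ≤ t from hx)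
        constructor <;> linarith
      have := hν.map_neg.smallBall_of_right h' (t := 2 * t) (by linarith)
      rw [map_measureReal_apply measurable_neg measurableSet_Ioc] at this
      linarith [measureReal_mono (μ := ν) hsub']
  rcases ht.eq_or_lt with rfl | ht
  · refine le_of_forall_pos_le_add fun δ hδ => ?_
    have := pos (δ / 655360) (by positivity)
    have hsub : {x : ℝ | |x| ≤ 0} ⊆ {x | |x| ≤ δ / 655360} := fun x hx =>
      le_trans (show |x| ≤ 0 from hx) (by positivity)
    linarith [measureReal_mono (μ := ν) hsub]
  · exact pos t ht

end SmallBall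

/-! ### Negative moments of vectors and of scalars. -/

lemma EuclideanSpace.enorm_sq_eq {ι : Type*} [Fintype ι] (y : EuclideanSpace ℝ ι) :
    ‖y‖ₑ ^ (2 : ℝ) = ∑ i, ‖y i‖ₑ ^ (2 : ℝ) := by
  have h := EuclideanSpace.norm_sq_eq y
  simp only [← ofReal_norm, ENNReal.rpow_two]
  rw [← ENNReal.ofReal_pow (norm_nonneg _), h, ENNReal.ofReal_sum_of_nonneg fun _ _ => sq_nonneg _]
  exact Finset.sum_congr rfl fun i _ => ENNReal.ofReal_pow (norm_nonneg _) _

/-- A weighted power mean inequality with a negative exponent. -/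
lemma EuclideanSpace.enorm_rpow_neg_mul_le {ι : Type*} [Fintype ι] {p : ℝ} (hp : 0 < p)
    (y τ : EuclideanSpace ℝ ι) :
    ‖y‖ₑ ^ (-p) * ‖τ‖ₑ ^ (2 + p) ≤ ∑ i, ‖τ i‖ₑ ^ (2 + p) * ‖y i‖ₑ ^ (-p) := by
  have h2p : 0 < 2 + p := by linarith
  -- Such a coordinate makes the right-hand side infinite; elsewhere the negative powers of `y i`
  -- can be cancelled.
  by_cases hex : ∃ i, τ i ≠ 0 ∧ y i = 0
  · obtain ⟨i, hi, hyi⟩ := hex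
    refine le_trans le_top (le_trans ?_ (Finset.single_le_sum
      (f := fun i => ‖τ i‖ₑ ^ (2 + p) * ‖y i‖ₑ ^ (-p)) (fun _ _ => zero_le) (Finset.mem_univ i)))
    rw [hyi, enorm_zero, ENNReal.zero_rpow_of_neg (by linarith), ENNReal.mul_top]
    simp [ENNReal.rpow_eq_zero_iff, hi, h2p.not_gt]
  push Not at hex
  set R := ∑ i, ‖τ i‖ₑ ^ (2 + p) * ‖y i‖ₑ ^ (-p) with hR
  by_cases hy : y = 0
  · have : τ = 0 := by
      ext i
      by_contra h
      exact hex i h (by simp [hy])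
    simp [this, ENNReal.zero_rpow_of_pos h2p]
  -- Hölder is applied to `τᵢ² = (τᵢ² yᵢ ^ (-2p/(2+p))) · yᵢ ^ (2p/(2+p))`, with exponents chosen so
  -- that the second factor sums to `‖y‖ ^ 2`.
  have hconj : ((2 + p) / 2).HolderConjugate ((2 + p) / p) := by
    rw [Real.holderConjugate_iff]
    constructor
    · rw [lt_div_iff₀ (by norm_num)]; linarith
    · field_simp
  have hol := ENNReal.inner_le_Lp_mul_Lq Finset.univ
    (fun i => ‖τ i‖ₑ ^ (2 : ℝ) * ‖y i‖ₑ ^ (-(2 * p / (2 + p))))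
    (fun i => ‖y i‖ₑ ^ (2 * p / (2 + p))) hconj
  have e1 : ‖τ‖ₑ ^ (2 : ℝ) ≤ ∑ i, ‖τ i‖ₑ ^ (2 : ℝ) * ‖y i‖ₑ ^ (-(2 * p / (2 + p))) *
      ‖y i‖ₑ ^ (2 * p / (2 + p)) := by
    rw [EuclideanSpace.enorm_sq_eq]
    refine Finset.sum_le_sum fun i _ => ?_
    by_cases hi : τ i = 0
    · simp [hi]
    · have hyi : ‖y i‖ₑ ≠ 0 := by simpa using hex i hi
      rw [mul_assoc, ← ENNReal.rpow_add _ _ hyi enorm_ne_top]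
      simp
  have e2 : ∑ i, (‖τ i‖ₑ ^ (2 : ℝ) * ‖y i‖ₑ ^ (-(2 * p / (2 + p)))) ^ ((2 + p) / 2) = R := by
    refine Finset.sum_congr rfl fun i _ => ?_
    rw [ENNReal.mul_rpow_of_nonneg _ _ (by positivity), ← ENNReal.rpow_mul, ← ENNReal.rpow_mul]
    congr 2 <;> field_simp
  have e3 : ∑ i, (‖y i‖ₑ ^ (2 * p / (2 + p))) ^ ((2 + p) / p) = ‖y‖ₑ ^ (2 : ℝ) := by
    rw [EuclideanSpace.enorm_sq_eq]
    refine Finset.sum_congr rfl fun i _ => ?_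
    rw [← ENNReal.rpow_mul]
    congr 1
    field_simp
  rw [e2, e3] at hol
  have h := ENNReal.rpow_le_rpow (e1.trans hol) (by positivity : 0 ≤ (2 + p) / 2)
  rw [ENNReal.mul_rpow_of_nonneg _ _ (by positivity), ← ENNReal.rpow_mul, ← ENNReal.rpow_mul,
    ← ENNReal.rpow_mul, ← ENNReal.rpow_mul,
    show 2 * ((2 + p) / 2) = 2 + p by ring, show 1 / ((2 + p) / 2) * ((2 + p) / 2) = 1 by field_simp,
    show 2 * (1 / ((2 + p) / p) * ((2 + p) / 2)) = p by field_simp, ENNReal.rpow_one] at h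
  have hy0 : ‖y‖ₑ ≠ 0 := by simpa using hy
  calc ‖y‖ₑ ^ (-p) * ‖τ‖ₑ ^ (2 + p) ≤ ‖y‖ₑ ^ (-p) * (R * ‖y‖ₑ ^ p) := by gcongr
    _ = R * (‖y‖ₑ ^ (-p) * ‖y‖ₑ ^ p) := by ring
    _ = R := by rw [← ENNReal.rpow_add _ _ hy0 enorm_ne_top]; simp

/-- Negative moment bounds for the coordinates of a random vector, relative to those of a
deterministic vector, give the same bound for the norms. -/
lemma lintegral_enorm_rpow_neg_le {α ι : Type*} [MeasurableSpace α] [Fintype ι] {μ : Measure α}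
    {p : ℝ} (hp : 0 < p) {K : ℝ≥0∞} (hK : K ≠ 0) {y : α → EuclideanSpace ℝ ι} (hy : Measurable y)
    {τ : EuclideanSpace ℝ ι} (h : ∀ i, ∫⁻ x, ‖y x i‖ₑ ^ (-p) ∂μ ≤ K * ‖τ i‖ₑ ^ (-p)) :
    ∫⁻ x, ‖y x‖ₑ ^ (-p) ∂μ ≤ K * ‖τ‖ₑ ^ (-p) := by
  have h2p : 0 < 2 + p := by linarith
  by_cases hτ : τ = 0
  · rw [hτ, enorm_zero, ENNReal.zero_rpow_of_neg (by linarith), ENNReal.mul_top hK]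
    exact le_top
  have hτ0 : ‖τ‖ₑ ≠ 0 := by simpa using hτ
  have hm : ∀ i, Measurable fun x => y x i := fun i =>
    (EuclideanSpace.proj (𝕜 := ℝ) i).continuous.measurable.comp hy
  have hle : (∫⁻ x, ‖y x‖ₑ ^ (-p) ∂μ) * ‖τ‖ₑ ^ (2 + p) ≤ K * ‖τ‖ₑ ^ (2 : ℝ) := by
    rw [← lintegral_mul_const _ (hy.enorm.pow_const _)]
    calc ∫⁻ x, ‖y x‖ₑ ^ (-p) * ‖τ‖ₑ ^ (2 + p) ∂μ
        ≤ ∫⁻ x, ∑ i, ‖τ i‖ₑ ^ (2 + p) * ‖y x i‖ₑ ^ (-p) ∂μ :=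
          lintegral_mono fun x => EuclideanSpace.enorm_rpow_neg_mul_le hp _ _
      _ = ∑ i, ‖τ i‖ₑ ^ (2 + p) * ∫⁻ x, ‖y x i‖ₑ ^ (-p) ∂μ := by
          rw [lintegral_finsetSum _ fun i _ => ((hm i).enorm.pow_const _).const_mul _]
          exact Finset.sum_congr rfl fun i _ =>
            lintegral_const_mul _ ((hm i).enorm.pow_const _)
      _ ≤ ∑ i, K * ‖τ i‖ₑ ^ (2 : ℝ) := by
          refine Finset.sum_le_sum fun i _ => ?_
          by_cases hi : τ i = 0
          · simp [hi, ENNReal.zero_rpow_of_pos h2p]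
          have hi0 : ‖τ i‖ₑ ≠ 0 := by simpa using hi
          calc ‖τ i‖ₑ ^ (2 + p) * ∫⁻ x, ‖y x i‖ₑ ^ (-p) ∂μ
              ≤ ‖τ i‖ₑ ^ (2 + p) * (K * ‖τ i‖ₑ ^ (-p)) := by gcongr; exact h i
            _ = K * (‖τ i‖ₑ ^ (2 + p) * ‖τ i‖ₑ ^ (-p)) := by ring
            _ = K * ‖τ i‖ₑ ^ (2 : ℝ) := by
              rw [← ENNReal.rpow_add _ _ hi0 enorm_ne_top]; congr 2; ring
      _ = K * ‖τ‖ₑ ^ (2 : ℝ) := by rw [← Finset.mul_sum, EuclideanSpace.enorm_sq_eq]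
  calc ∫⁻ x, ‖y x‖ₑ ^ (-p) ∂μ
      = (∫⁻ x, ‖y x‖ₑ ^ (-p) ∂μ) * (‖τ‖ₑ ^ (2 + p) * ‖τ‖ₑ ^ (-(2 + p))) := by
        rw [← ENNReal.rpow_add _ _ hτ0 enorm_ne_top]; simp
    _ = (∫⁻ x, ‖y x‖ₑ ^ (-p) ∂μ) * ‖τ‖ₑ ^ (2 + p) * ‖τ‖ₑ ^ (-(2 + p)) := by ring
    _ ≤ K * ‖τ‖ₑ ^ (2 : ℝ) * ‖τ‖ₑ ^ (-(2 + p)) := by gcongr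
    _ = K * ‖τ‖ₑ ^ (-p) := by
        rw [mul_assoc, ← ENNReal.rpow_add _ _ hτ0 enorm_ne_top]; congr 2; ring

/-- A linear small ball estimate bounds the negative moments of order less than one. -/
lemma lintegral_enorm_rpow_neg_le_of_smallBall {α : Type*} [MeasurableSpace α] {μ : Measure α}
    [IsProbabilityMeasure μ] {Z : α → ℝ} (hZ : Measurable Z) {C : ℝ} (hC : 1 ≤ C)
    (h : ∀ t, 0 ≤ t → μ.real {x | |Z x| ≤ t} ≤ C * t) {p : ℝ} (hp0 : 0 < p) (hp1 : p < 1) :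
    ∫⁻ x, ‖Z x‖ₑ ^ (-p) ∂μ ≤ ENNReal.ofReal (C / (1 - p)) := by
  have h1p : 0 < 1 - p := by linarith
  have hae : ∀ᵐ x ∂μ, Z x ≠ 0 := by
    rw [ae_iff]
    have h0 := h 0 le_rfl
    rw [mul_zero] at h0
    have : μ.real {x | |Z x| ≤ 0} = 0 := le_antisymm h0 measureReal_nonneg
    rw [measureReal_eq_zero_iff] at this
    refine measure_mono_null (fun x hx => ?_) this
    simp only [ne_eq, not_not, Set.mem_ofPred_eq] at hx ⊢
    simp [hx]
  have e : ∫⁻ x, ‖Z x‖ₑ ^ (-p) ∂μ = ∫⁻ x, ENNReal.ofReal (|Z x| ^ (-p)) ∂μ := by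
    refine lintegral_congr_ae (hae.mono fun x hx => ?_)
    simp only
    rw [← ENNReal.ofReal_rpow_of_pos (abs_pos.2 hx), ← Real.norm_eq_abs, ofReal_norm]
  rw [e, lintegral_eq_lintegral_meas_lt μ
    (Filter.Eventually.of_forall fun x => Real.rpow_nonneg (abs_nonneg _) _)
    ((measurable_norm.comp hZ).pow_const _).aemeasurable]
  have hsub : ∀ t : ℝ, 0 < t → μ {x | t < |Z x| ^ (-p)} ≤ ENNReal.ofReal (C * t ^ (-(1 / p))) := by
    intro t ht
    rw [← ofReal_measureReal]
    refine ENNReal.ofReal_le_ofReal (le_trans (measureReal_mono fun x hx => ?_)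
      (h (t ^ (-(1 / p))) (by positivity)))
    have hx' : t < |Z x| ^ (-p) := hx
    rcases (abs_nonneg (Z x)).eq_or_lt with h0 | h0
    · rw [← h0, Real.zero_rpow (by linarith)] at hx'
      linarith
    · have := Real.rpow_le_rpow_of_nonpos ht hx'.le (by simp [hp0.le] : -(1 / p) ≤ 0)
      rw [← Real.rpow_mul h0.le, show -p * -(1 / p) = 1 by field_simp, Real.rpow_one] at this
      exact this
  have hexp : -(1 / p) < -1 := by
    have : 1 < 1 / p := by rw [lt_div_iff₀ hp0]; linarith
    linarith
  -- Levels up to `1` contribute at most `1`, the others `C p / (1 - p)`; the sum is at most `C / (1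
  -- - p)` because `C ≥ 1`.
  calc ∫⁻ t in Set.Ioi 0, μ {x | t < |Z x| ^ (-p)}
      ≤ (∫⁻ t in Set.Ioc 0 1, μ {x | t < |Z x| ^ (-p)}) +
        ∫⁻ t in Set.Ioi 1, μ {x | t < |Z x| ^ (-p)} := by
        rw [← Set.Ioc_union_Ioi_eq_Ioi (zero_le_one (α := ℝ))]
        exact lintegral_union_le _ _ _
    _ ≤ (∫⁻ t in Set.Ioc (0 : ℝ) 1, 1) +
        ∫⁻ t in Set.Ioi (1 : ℝ), ENNReal.ofReal (C * t ^ (-(1 / p))) := by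
        refine add_le_add (lintegral_mono fun t => prob_le_one) ?_
        exact setLIntegral_mono' measurableSet_Ioi fun t ht => hsub t (zero_lt_one.trans ht)
    _ = ENNReal.ofReal 1 + ENNReal.ofReal (C * (p / (1 - p))) := by
        congr 1
        · simp
        · rw [← ofReal_integral_eq_lintegral_ofReal]
          · rw [integral_const_mul, integral_Ioi_rpow_of_lt hexp zero_lt_one]
            congr 2
            rw [Real.one_rpow]
            have h1 : -(1 / p) + 1 = -((1 - p) / p) := by field_simp; ring
            rw [h1, neg_div_neg_eq, one_div_div]
          · exact (integrableOn_Ioi_rpow_of_lt hexp zero_lt_one).const_mul C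
          · refine (ae_restrict_iff' measurableSet_Ioi).2 (Filter.Eventually.of_forall fun t ht => ?_)
            have : 0 < t := zero_lt_one.trans ht
            exact mul_nonneg (by linarith) (Real.rpow_nonneg this.le _)
    _ ≤ ENNReal.ofReal (C / (1 - p)) := by
        rw [← ENNReal.ofReal_add zero_le_one (by positivity)]
        refine ENNReal.ofReal_le_ofReal ?_
        rw [le_div_iff₀ h1p]
        field_simp
        nlinarith

/-! ### Small ball estimates for linear functionals. -/

/-- Linear functionals of unit norm satisfy `μ(|⟨x, v⟩| ≤ t) ≤ C t`. -/
def HasSmallBall {E : Type*} [NormedAddCommGroup E] [InnerProductSpace ℝ E] [MeasurableSpace E]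
    (μ : Measure E) (C : ℝ) : Prop :=
  ∀ v : E, ‖v‖ = 1 → ∀ t, 0 ≤ t → μ.real {x | |inner ℝ x v| ≤ t} ≤ C * t

section

variable {E : Type*} [NormedAddCommGroup E] [InnerProductSpace ℝ E] [MeasurableSpace E]
  {μ : Measure E} {C : ℝ}

lemma HasSmallBall.measureReal_le (h : HasSmallBall μ C) {v : E} (hv : v ≠ 0) {t : ℝ}
    (ht : 0 ≤ t) : μ.real {x | |inner ℝ x v| ≤ t} ≤ C * (t / ‖v‖) := by
  have hn : 0 < ‖v‖ := norm_pos_iff.2 hv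
  convert h (‖v‖⁻¹ • v) (by rw [norm_smul, norm_inv, norm_norm, inv_mul_cancel₀ hn.ne'])
    (t / ‖v‖) (by positivity) using 3
  ext x
  rw [inner_smul_right, abs_mul, abs_of_pos (inv_pos.2 hn), le_div_iff₀ hn]
  congr! 1
  field_simp

lemma HasSmallBall.lintegral_enorm_inner_rpow_neg_le [BorelSpace E] [IsProbabilityMeasure μ]
    (h : HasSmallBall μ C) (hC : 1 ≤ C) {p : ℝ}
    (hp0 : 0 < p) (hp1 : p < 1) (v : E) :
    ∫⁻ x, ‖inner ℝ x v‖ₑ ^ (-p) ∂μ ≤ ENNReal.ofReal (C / (1 - p)) * ‖v‖ₑ ^ (-p) := by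
  have h1p : 0 < 1 - p := by linarith
  by_cases hv : v = 0
  · rw [hv, enorm_zero, ENNReal.zero_rpow_of_neg (by linarith), ENNReal.mul_top]
    · exact le_top
    · simp only [ne_eq, ENNReal.ofReal_eq_zero, not_le]; positivity
  have hn : 0 < ‖v‖ := norm_pos_iff.2 hv
  have hm : ∀ w : E, Measurable fun x : E => inner ℝ x w := fun w =>
    (continuous_id.inner continuous_const).measurable
  have key := lintegral_enorm_rpow_neg_le_of_smallBall (hm (‖v‖⁻¹ • v)) hC
    (h (‖v‖⁻¹ • v) (by rw [norm_smul, norm_inv, norm_norm, inv_mul_cancel₀ hn.ne'])) hp0 hp1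
  have e : ∀ x : E, ‖inner ℝ x v‖ₑ ^ (-p) =
      ‖inner ℝ x (‖v‖⁻¹ • v)‖ₑ ^ (-p) * ‖v‖ₑ ^ (-p) := by
    intro x
    have e1 : inner ℝ x v = inner ℝ x (‖v‖⁻¹ • v) * ‖v‖ := by
      rw [inner_smul_right]; field_simp
    rw [e1, enorm_mul, enorm_norm, ENNReal.mul_rpow_of_ne_top enorm_ne_top enorm_ne_top]
  simp only [e]
  rw [lintegral_mul_const _ ((hm _).enorm.pow_const _)]
  gcongr

/-- Being a probability, the left side is at most `min 1 (C s) ≤ C s ^ p` with `s = ε / ‖v‖`.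
Weakening to the power `p` leaves a negative moment of `‖v‖`, which stays finite on average when `v`
is a random contraction. -/
lemma HasSmallBall.measure_le_rpow [IsProbabilityMeasure μ] (h : HasSmallBall μ C) (hC : 1 ≤ C) {p : ℝ} (hp0 : 0 < p)
    (hp1 : p < 1) {ε : ℝ} (hε : 0 < ε) (v : E) :
    μ {x | |inner ℝ x v| ≤ ε} ≤ ENNReal.ofReal (C * ε ^ p) * ‖v‖ₑ ^ (-p) := by
  have hpos : 0 < C * ε ^ p := by positivity
  by_cases hv : v = 0
  · rw [hv, enorm_zero, ENNReal.zero_rpow_of_neg (by linarith), ENNReal.mul_top]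
    · exact le_top
    · simpa using hpos
  have hn : 0 < ‖v‖ := norm_pos_iff.2 hv
  rw [← ofReal_norm, ENNReal.ofReal_rpow_of_pos hn, ← ENNReal.ofReal_mul hpos.le,
    ← ofReal_measureReal]
  refine ENNReal.ofReal_le_ofReal ?_
  have e : C * ε ^ p * ‖v‖ ^ (-p) = C * (ε / ‖v‖) ^ p := by
    rw [Real.div_rpow hε.le hn.le, Real.rpow_neg hn.le]; ring
  rw [e]
  rcases le_total ε ‖v‖ with hle | hle
  · refine (h.measureReal_le hv hε.le).trans ?_
    gcongr
    exact Real.self_le_rpow_of_le_one (by positivity) ((div_le_one hn).2 hle) hp1.le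
  · refine measureReal_le_one.trans ?_
    have : 1 ≤ (ε / ‖v‖) ^ p := Real.one_le_rpow ((one_le_div hn).2 hle) hp0.le
    nlinarith

end

/-- Isotropic log-concave random vectors satisfy a small ball estimate. -/
theorem hasSmallBall_of_isLogConcaveVector {Ω : Type*} [MeasurableSpace Ω] {P : Measure Ω}
    [IsProbabilityMeasure P] {n : ℕ} {X : Ω → EuclideanSpace ℝ (Fin n)} (hX : Measurable X)
    (hlc : IsLogConcaveVector P X) (hiso : IsIsotropicVector P X) :
    HasSmallBall (P.map X) 655360 := by
  intro v hv t ht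
  obtain ⟨f, hfm, hf, hmap⟩ := hlc
  have hm : Measurable fun x : EuclideanSpace ℝ (Fin n) => inner ℝ x v :=
    (continuous_id.inner continuous_const).measurable
  have : IsProbabilityMeasure (P.map X) := Measure.isProbabilityMeasure_map hX.aemeasurable
  have : IsProbabilityMeasure ((P.map X).map fun x => inner ℝ x v) :=
    Measure.isProbabilityMeasure_map hm.aemeasurable
  have hL : IsLogConcaveMeasure ((P.map X).map fun x => inner ℝ x v) := by
    rw [hmap]
    have e : (fun x : EuclideanSpace ℝ (Fin n) => inner ℝ x v) = ⇑(innerSL ℝ v) := by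
      ext x
      rw [innerSL_apply_apply, real_inner_comm]
    rw [e]
    exact hf.isLogConcaveMeasure_map hfm (innerSL ℝ v)
  -- Isotropy gives `E ⟨X, v⟩ ^ 2 = ‖v‖ ^ 2 = 1`.
  have h2 : ∫⁻ x, ENNReal.ofReal (x ^ 2) ∂((P.map X).map fun x => inner ℝ x v) = 1 := by
    rw [lintegral_map (by fun_prop) hm, lintegral_map (by fun_prop) hX]
    have e : ∀ ω, inner ℝ (X ω) v ^ 2 = ∑ i, ∑ j, v i * v j * (X ω i * X ω j) := by
      intro ω
      rw [PiLp.inner_apply, sq, Finset.sum_mul_sum]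
      refine Finset.sum_congr rfl fun i _ => Finset.sum_congr rfl fun j _ => ?_
      simp only [RCLike.inner_apply, conj_trivial]
      ring
    have hint : ∀ i j, Integrable (fun ω => v i * v j * (X ω i * X ω j)) P := fun i j =>
      (hiso i j).1.const_mul _
    have hint' : Integrable (fun ω => inner ℝ (X ω) v ^ 2) P := by
      simp only [e]
      exact integrable_finsetSum _ fun i _ => integrable_finsetSum _ fun j _ => hint i j
    rw [← ofReal_integral_eq_lintegral_ofReal hint'
      (Filter.Eventually.of_forall fun ω => sq_nonneg _)]
    have : ∫ ω, inner ℝ (X ω) v ^ 2 ∂P = 1 := by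
      simp only [e]
      rw [integral_finsetSum _ fun i _ => integrable_finsetSum _ fun j _ => hint i j]
      simp_rw [integral_finsetSum _ fun j _ => hint _ j, integral_const_mul, (hiso _ _).2,
        Matrix.one_apply]
      have hv2 := EuclideanSpace.norm_sq_eq v
      rw [hv, one_pow] at hv2
      simp only [mul_ite, mul_one, mul_zero, Finset.sum_ite_eq, Finset.mem_univ, if_true]
      rw [hv2]
      exact Finset.sum_congr rfl fun i _ => by rw [Real.norm_eq_abs, sq_abs, sq]
    rw [this, ENNReal.ofReal_one]
  have := hL.smallBall h2 ht
  rwa [map_measureReal_apply hm (measurableSet_le continuous_abs.measurable measurable_const)] at this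

/-! ### Contractions and negative moments of simple tensors. -/

lemma measurePreserving_finCons {ℓ : ℕ} {E : Fin (ℓ + 1) → Type*} [∀ j, MeasurableSpace (E j)]
    (μ : ∀ j, Measure (E j)) [∀ j, SigmaFinite (μ j)] :
    MeasurePreserving (fun z : E 0 × (∀ j : Fin ℓ, E j.succ) => (Fin.cons z.1 z.2 : ∀ j, E j))
      ((μ 0).prod (Measure.pi fun j : Fin ℓ => μ j.succ)) (Measure.pi μ) := by
  have hm : Measurable
      (fun z : E 0 × (∀ j : Fin ℓ, E j.succ) => (Fin.cons z.1 z.2 : ∀ j, E j)) := by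
    refine measurable_pi_iff.2 fun j => ?_
    refine Fin.cases ?_ (fun j => ?_) j
    · exact measurable_fst
    · exact (measurable_pi_apply j).comp measurable_snd
  refine ⟨hm, (Measure.pi_eq fun s hs => ?_).symm⟩
  rw [Measure.map_apply hm (MeasurableSet.univ_pi hs)]
  have : (fun z : E 0 × (∀ j : Fin ℓ, E j.succ) => (Fin.cons z.1 z.2 : ∀ j, E j)) ⁻¹'
      Set.univ.pi s = s 0 ×ˢ Set.univ.pi fun j : Fin ℓ => s j.succ := by
    ext z
    simp [Set.mem_pi, Fin.forall_fin_succ]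
  rw [this, Measure.prod_prod, Measure.pi_pi, Fin.prod_univ_succ]

section Contraction

variable {ℓ : ℕ} {n : Fin (ℓ + 1) → ℕ}

/-- The slice of a tensor obtained by fixing the first index. -/
noncomputable def RealTensor.slice (T : RealTensor n) (a : Fin (n 0)) :
    RealTensor (fun j : Fin ℓ => n j.succ) :=
  WithLp.toLp 2 fun i => T (Fin.cons a i)

/-- The contraction of a tensor with a simple tensor in all slots but the first. -/
noncomputable def RealTensor.contract (T : RealTensor n)
    (x : (j : Fin ℓ) → EuclideanSpace ℝ (Fin (n j.succ))) : EuclideanSpace ℝ (Fin (n 0)) :=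
  WithLp.toLp 2 fun a => inner ℝ (simpleTensor x) (T.slice a)

/-- The vector of norms of the slices of a tensor. -/
noncomputable def RealTensor.sliceNorms (T : RealTensor n) : EuclideanSpace ℝ (Fin (n 0)) :=
  WithLp.toLp 2 fun a => ‖T.slice a‖

lemma sum_fin_cons {M : Type*} [AddCommMonoid M] (g : ((j : Fin (ℓ + 1)) → Fin (n j)) → M) :
    ∑ i, g i = ∑ a : Fin (n 0), ∑ i : (j : Fin ℓ) → Fin (n j.succ), g (Fin.cons a i) := by
  rw [← (Fin.consEquiv fun j => Fin (n j)).sum_comp, Fintype.sum_prod_type]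
  rfl

lemma inner_simpleTensor_cons (T : RealTensor n) (x₀ : EuclideanSpace ℝ (Fin (n 0)))
    (x : (j : Fin ℓ) → EuclideanSpace ℝ (Fin (n j.succ))) :
    inner ℝ (simpleTensor (Fin.cons x₀ x : ∀ j, EuclideanSpace ℝ (Fin (n j)))) T =
      inner ℝ x₀ (T.contract x) := by
  simp only [PiLp.inner_apply, RealTensor.contract, RealTensor.slice, simpleTensor,
    RCLike.inner_apply, conj_trivial]
  rw [sum_fin_cons]
  refine Finset.sum_congr rfl fun a _ => ?_
  rw [Finset.sum_mul]
  refine Finset.sum_congr rfl fun i _ => ?_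
  rw [Fin.prod_univ_succ]
  simp only [Fin.cons_zero, Fin.cons_succ]
  ring

/-- Serving as the comparison vector `τ` in `lintegral_enorm_rpow_neg_le`, the slice norms return
exactly `‖T‖`, so the induction loses nothing beyond `K` per factor. -/
lemma RealTensor.norm_sliceNorms (T : RealTensor n) : ‖T.sliceNorms‖ = ‖T‖ := by
  rw [← sq_eq_sq₀ (norm_nonneg _) (norm_nonneg _), EuclideanSpace.norm_sq_eq,
    EuclideanSpace.norm_sq_eq, sum_fin_cons]
  refine Finset.sum_congr rfl fun a _ => ?_
  simp only [RealTensor.sliceNorms, norm_norm]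
  rw [EuclideanSpace.norm_sq_eq]
  rfl

end Contraction

lemma measurable_simpleTensor {ℓ : ℕ} {n : Fin ℓ → ℕ} :
    Measurable (simpleTensor : ((j : Fin ℓ) → EuclideanSpace ℝ (Fin (n j))) → RealTensor n) := by
  have : Continuous
      (simpleTensor : ((j : Fin ℓ) → EuclideanSpace ℝ (Fin (n j))) → RealTensor n) := by
    unfold simpleTensor
    fun_prop
  exact this.measurable

lemma measurable_inner_simpleTensor {ℓ : ℕ} {n : Fin ℓ → ℕ} (T : RealTensor n) :
    Measurable fun x : (j : Fin ℓ) → EuclideanSpace ℝ (Fin (n j)) => inner ℝ (simpleTensor x) T :=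
  measurable_simpleTensor.inner measurable_const

lemma RealTensor.measurable_contract {ℓ : ℕ} {n : Fin (ℓ + 1) → ℕ} (T : RealTensor n) :
    Measurable T.contract :=
  (PiLp.continuous_toLp 2 _).measurable.comp
    (measurable_pi_iff.2 fun a => measurable_inner_simpleTensor (T.slice a))

/-- Negative moments of linear functionals of random simple tensors with independent factors. -/
theorem lintegral_enorm_inner_simpleTensor_rpow_neg_le {p : ℝ} (hp : 0 < p) {K : ℝ≥0∞}
    (hK0 : K ≠ 0) {ℓ : ℕ} {n : Fin ℓ → ℕ}
    (μ : (j : Fin ℓ) → Measure (EuclideanSpace ℝ (Fin (n j)))) [∀ j, IsProbabilityMeasure (μ j)]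
    (h : ∀ j v, ∫⁻ x, ‖inner ℝ x v‖ₑ ^ (-p) ∂μ j ≤ K * ‖v‖ₑ ^ (-p)) (T : RealTensor n) :
    ∫⁻ x, ‖inner ℝ (simpleTensor x) T‖ₑ ^ (-p) ∂Measure.pi μ ≤ K ^ ℓ * ‖T‖ₑ ^ (-p) := by
  induction ℓ with
  | zero =>
    have e : ∀ x : (j : Fin 0) → EuclideanSpace ℝ (Fin (n j)),
        ‖inner ℝ (simpleTensor x) T‖ₑ = ‖T‖ₑ := by
      intro x
      have h2 := EuclideanSpace.norm_sq_eq T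
      rw [Fintype.sum_unique, sq_eq_sq₀ (norm_nonneg _) (norm_nonneg _)] at h2
      rw [← ofReal_norm, ← ofReal_norm, h2, PiLp.inner_apply, Fintype.sum_unique]
      simp [simpleTensor]
    simp [e]
  | succ ℓ ih =>
    have g : Measurable fun z : EuclideanSpace ℝ (Fin (n 0)) ×
        ((j : Fin ℓ) → EuclideanSpace ℝ (Fin (n j.succ))) =>
        ‖inner ℝ (simpleTensor
          (Fin.cons z.1 z.2 : ∀ j, EuclideanSpace ℝ (Fin (n j)))) T‖ₑ ^ (-p) :=
      ((measurable_inner_simpleTensor T).enorm.pow_const _).comp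
        (measurePreserving_finCons μ).measurable
    rw [← (measurePreserving_finCons μ).lintegral_comp
        ((measurable_inner_simpleTensor T).enorm.pow_const _),
      lintegral_prod_symm _ g.aemeasurable]
    calc ∫⁻ x, ∫⁻ x₀, ‖inner ℝ (simpleTensor
            (Fin.cons x₀ x : ∀ j, EuclideanSpace ℝ (Fin (n j)))) T‖ₑ ^ (-p) ∂μ 0
            ∂Measure.pi (fun j : Fin ℓ => μ j.succ)
        -- The first factor is integrated with the others frozen; the induction hypothesis then
        -- applies to each coordinate of the contraction.
        ≤ ∫⁻ x, K * ‖T.contract x‖ₑ ^ (-p) ∂Measure.pi (fun j : Fin ℓ => μ j.succ) := by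
          refine lintegral_mono fun x => ?_
          simp only [inner_simpleTensor_cons]
          exact h 0 _
      _ = K * ∫⁻ x, ‖T.contract x‖ₑ ^ (-p) ∂Measure.pi (fun j : Fin ℓ => μ j.succ) :=
          lintegral_const_mul _ (T.measurable_contract.enorm.pow_const _)
      _ ≤ K * (K ^ ℓ * ‖T.sliceNorms‖ₑ ^ (-p)) := by
          gcongr
          refine lintegral_enorm_rpow_neg_le hp (pow_ne_zero _ hK0) T.measurable_contract
            fun a => ?_
          simp only [RealTensor.contract, RealTensor.sliceNorms, enorm_norm]
          exact ih (fun j : Fin ℓ => μ j.succ) (fun j v => h j.succ v) (T.slice a)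
      _ = K ^ (ℓ + 1) * ‖T‖ₑ ^ (-p) := by
          rw [← ofReal_norm T.sliceNorms, T.norm_sliceNorms, ofReal_norm, pow_succ']
          ring

/-- Negative moments of contractions of a tensor with a random simple tensor. -/
theorem lintegral_enorm_contract_rpow_neg_le {p : ℝ} (hp : 0 < p) {K : ℝ≥0∞}
    (hK0 : K ≠ 0) {ℓ : ℕ} {n : Fin (ℓ + 1) → ℕ}
    (μ : (j : Fin ℓ) → Measure (EuclideanSpace ℝ (Fin (n j.succ))))
    [∀ j, IsProbabilityMeasure (μ j)]
    (h : ∀ j v, ∫⁻ x, ‖inner ℝ x v‖ₑ ^ (-p) ∂μ j ≤ K * ‖v‖ₑ ^ (-p)) (T : RealTensor n) :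
    ∫⁻ x, ‖T.contract x‖ₑ ^ (-p) ∂Measure.pi μ ≤ K ^ ℓ * ‖T‖ₑ ^ (-p) := by
  rw [← ofReal_norm T, ← T.norm_sliceNorms, ofReal_norm]
  refine lintegral_enorm_rpow_neg_le hp (pow_ne_zero _ hK0) T.measurable_contract fun a => ?_
  simp only [RealTensor.contract, RealTensor.sliceNorms, enorm_norm]
  exact lintegral_enorm_inner_simpleTensor_rpow_neg_le hp hK0 μ h (T.slice a)

/-! ### Tail bounds with a free exponent `p`. -/

section Tail

variable {C p : ℝ}

/-- The first factor is spent on its small ball bound, so only the remaining `ℓ` of the `ℓ + 1`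
factors cost `C / (1 - p)`. This saves one logarithm over Markov's inequality. -/
lemma HasSmallBall.measure_pi_abs_inner_le (hC : 1 ≤ C) (hp0 : 0 < p) (hp1 : p < 1) {ℓ : ℕ}
    {n : Fin (ℓ + 1) → ℕ} {μ : (j : Fin (ℓ + 1)) → Measure (EuclideanSpace ℝ (Fin (n j)))}
    [∀ j, IsProbabilityMeasure (μ j)] (h : ∀ j, HasSmallBall (μ j) C) {T : RealTensor n}
    (hT : ‖T‖ = 1) {ε : ℝ} (hε : 0 < ε) :
    Measure.pi μ {x | |inner ℝ (simpleTensor x) T| ≤ ε} ≤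
      ENNReal.ofReal (C * ε ^ p * (C / (1 - p)) ^ ℓ) := by
  have hK : 0 < C / (1 - p) := by apply div_pos <;> linarith
  have hms : MeasurableSet {x : (j : Fin (ℓ + 1)) → EuclideanSpace ℝ (Fin (n j)) |
      |inner ℝ (simpleTensor x) T| ≤ ε} :=
    measurableSet_le (continuous_abs.measurable.comp (measurable_inner_simpleTensor T))
      measurable_const
  have hmp := measurePreserving_finCons μ
  rw [← hmp.measure_preimage hms.nullMeasurableSet, Measure.prod_apply_symm (hmp.measurable hms)]
  calc ∫⁻ x, μ 0 {x₀ | |inner ℝ (simpleTensor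
          (Fin.cons x₀ x : ∀ j, EuclideanSpace ℝ (Fin (n j)))) T| ≤ ε}
          ∂Measure.pi (fun j : Fin ℓ => μ j.succ)
      ≤ ∫⁻ x, ENNReal.ofReal (C * ε ^ p) * ‖T.contract x‖ₑ ^ (-p)
          ∂Measure.pi (fun j : Fin ℓ => μ j.succ) := by
        refine lintegral_mono fun x => ?_
        simp only [inner_simpleTensor_cons]
        exact (h 0).measure_le_rpow hC hp0 hp1 hε _
    _ = ENNReal.ofReal (C * ε ^ p) * ∫⁻ x, ‖T.contract x‖ₑ ^ (-p)
          ∂Measure.pi (fun j : Fin ℓ => μ j.succ) :=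
        lintegral_const_mul _ (T.measurable_contract.enorm.pow_const _)
    _ ≤ ENNReal.ofReal (C * ε ^ p) * (ENNReal.ofReal (C / (1 - p)) ^ ℓ * ‖T‖ₑ ^ (-p)) := by
        gcongr
        exact lintegral_enorm_contract_rpow_neg_le hp0 (by simpa using hK)
          _ (fun j v => (h j.succ).lintegral_enorm_inner_rpow_neg_le hC hp0 hp1 v) T
    _ = ENNReal.ofReal (C * ε ^ p * (C / (1 - p)) ^ ℓ) := by
        rw [← ofReal_norm T, hT, ENNReal.ofReal_one, ENNReal.one_rpow, mul_one,
          ← ENNReal.ofReal_pow hK.le, ← ENNReal.ofReal_mul (by positivity)]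

lemma OrthonormalBasis.norm_starProjection_sq {H : Type*} [NormedAddCommGroup H]
    [InnerProductSpace ℝ H] {F : Submodule ℝ H} [F.HasOrthogonalProjection] {ι : Type*} [Fintype ι]
    (f : OrthonormalBasis ι ℝ F) (y : H) :
    ‖F.starProjection y‖ ^ 2 = ∑ k, inner ℝ y (f k : H) ^ 2 := by
  rw [Submodule.starProjection_apply, Submodule.norm_coe, ← f.sum_sq_norm_inner_right]
  refine Finset.sum_congr rfl fun k _ => ?_
  rw [Submodule.inner_orthogonalProjectionOnto_eq_of_mem_left, Real.norm_eq_abs, sq_abs,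
    real_inner_comm]

/-- Markov's inequality for the negative moment of the norm. The comparison vector is all ones, of
norm `√m`, which cancels the `√m` of the threshold and leaves no dependence on `m`. -/
lemma HasSmallBall.measure_pi_norm_starProjection_le (hC : 1 ≤ C) (hp0 : 0 < p) (hp1 : p < 1)
    {ℓ : ℕ} {n : Fin ℓ → ℕ} {μ : (j : Fin ℓ) → Measure (EuclideanSpace ℝ (Fin (n j)))}
    [∀ j, IsProbabilityMeasure (μ j)] (h : ∀ j, HasSmallBall (μ j) C)
    {F : Submodule ℝ (RealTensor n)} {m : ℕ} (hm : 1 ≤ m) (f : OrthonormalBasis (Fin m) ℝ F)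
    {ε : ℝ} (hε : 0 < ε) :
    Measure.pi μ {x | ‖F.starProjection (simpleTensor x)‖ ≤ ε * √m} ≤
      ENNReal.ofReal (ε ^ p * (C / (1 - p)) ^ ℓ) := by
  have hK : 0 < C / (1 - p) := by apply div_pos <;> linarith
  have hm0 : (0 : ℝ) < m := by exact_mod_cast hm
  set y : ((j : Fin ℓ) → EuclideanSpace ℝ (Fin (n j))) → EuclideanSpace ℝ (Fin m) := fun x =>
    WithLp.toLp 2 fun k => inner ℝ (simpleTensor x) (f k : RealTensor n)
  have hy : Measurable y := (PiLp.continuous_toLp 2 _).measurable.comp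
    (measurable_pi_iff.2 fun k => measurable_inner_simpleTensor _)
  have hny : ∀ x, ‖F.starProjection (simpleTensor x)‖ = ‖y x‖ := by
    intro x
    rw [← sq_eq_sq₀ (norm_nonneg _) (norm_nonneg _), f.norm_starProjection_sq,
      EuclideanSpace.norm_sq_eq]
    simp [y]
  set τ : EuclideanSpace ℝ (Fin m) := WithLp.toLp 2 fun _ => 1
  have hτ : ‖τ‖ = √m := by
    rw [EuclideanSpace.norm_eq]; simp [τ]
  have hmom : ∫⁻ x, ‖y x‖ₑ ^ (-p) ∂Measure.pi μ ≤
      ENNReal.ofReal (C / (1 - p)) ^ ℓ * ‖τ‖ₑ ^ (-p) := by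
    refine lintegral_enorm_rpow_neg_le hp0 (pow_ne_zero _ (by simpa using hK)) hy fun k => ?_
    have := lintegral_enorm_inner_simpleTensor_rpow_neg_le hp0 (by simpa using hK) μ
      (fun j v => (h j).lintegral_enorm_inner_rpow_neg_le hC hp0 hp1 v) (f k : RealTensor n)
    have hf : ‖(f k : RealTensor n)‖ = 1 := f.norm_eq_one k
    rw [← ofReal_norm (f k : RealTensor n), hf] at this
    simpa [y, τ] using this
  have hr : 0 < ε * √m := by positivity
  have hsub : {x | ‖F.starProjection (simpleTensor x)‖ ≤ ε * √m} ⊆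
      {x | ENNReal.ofReal ((ε * √m) ^ (-p)) ≤ ‖y x‖ₑ ^ (-p)} := by
    intro x hx
    have hx' : ‖y x‖ ≤ ε * √m := (hny x).symm ▸ hx
    simp only [Set.mem_ofPred_eq]
    rw [← ENNReal.ofReal_rpow_of_pos hr, ← ofReal_norm]
    rw [ENNReal.rpow_neg, ENNReal.rpow_neg]
    exact ENNReal.inv_le_inv.2 (ENNReal.rpow_le_rpow (ENNReal.ofReal_le_ofReal hx') hp0.le)
  have hmarkov := mul_meas_ge_le_lintegral₀ (μ := Measure.pi μ)
    (hy.enorm.pow_const (-p)).aemeasurable (ENNReal.ofReal ((ε * √m) ^ (-p)))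
  have hinv : ENNReal.ofReal ((ε * √m) ^ p) * ENNReal.ofReal ((ε * √m) ^ (-p)) = 1 := by
    rw [← ENNReal.ofReal_mul (by positivity), ← Real.rpow_add hr]; simp
  calc Measure.pi μ {x | ‖F.starProjection (simpleTensor x)‖ ≤ ε * √m}
      ≤ Measure.pi μ {x | ENNReal.ofReal ((ε * √m) ^ (-p)) ≤ ‖y x‖ₑ ^ (-p)} := measure_mono hsub
    _ = ENNReal.ofReal ((ε * √m) ^ p) * (ENNReal.ofReal ((ε * √m) ^ (-p)) *
        Measure.pi μ {x | ENNReal.ofReal ((ε * √m) ^ (-p)) ≤ ‖y x‖ₑ ^ (-p)}) := by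
        rw [← mul_assoc, hinv, one_mul]
    _ ≤ ENNReal.ofReal ((ε * √m) ^ p) *
        (ENNReal.ofReal (C / (1 - p)) ^ ℓ * ‖τ‖ₑ ^ (-p)) := by
        exact mul_le_mul_right (hmarkov.trans hmom) _
    _ = ENNReal.ofReal (ε ^ p * (C / (1 - p)) ^ ℓ) := by
        have hs : 0 < √(m : ℝ) := by positivity
        rw [← ofReal_norm τ, hτ, ENNReal.ofReal_rpow_of_pos hs, ← ENNReal.ofReal_pow hK.le,
          ← ENNReal.ofReal_mul (by positivity), ← ENNReal.ofReal_mul (by positivity),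
          Real.mul_rpow hε.le hs.le, Real.rpow_neg hs.le]
        congr 1
        have : √(m : ℝ) ^ p ≠ 0 := by positivity
        field_simp

end Tail

lemma OrthonormalBasis.exists_abs_inner_le_of_norm_starProjection_le {H : Type*}
    [NormedAddCommGroup H] [InnerProductSpace ℝ H] {F : Submodule ℝ H} [F.HasOrthogonalProjection]
    {m : ℕ} (hm : 1 ≤ m) (f : OrthonormalBasis (Fin m) ℝ F) {ε : ℝ} (hε : 0 < ε) {y : H}
    (h : ‖F.starProjection y‖ ≤ ε * √m) : ∃ k, |inner ℝ y (f k : H)| ≤ ε := by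
  by_contra! hc
  have : Nonempty (Fin m) := ⟨⟨0, hm⟩⟩
  have h1 : ∑ _k : Fin m, ε ^ 2 < ∑ k, inner ℝ y (f k : H) ^ 2 := by
    refine Finset.sum_lt_sum_of_nonempty Finset.univ_nonempty fun k _ => ?_
    rw [← sq_abs (inner ℝ y (f k : H))]
    have := hc k
    gcongr
  have h2 : ‖F.starProjection y‖ ^ 2 ≤ (ε * √m) ^ 2 := by gcongr
  rw [f.norm_starProjection_sq, mul_pow, Real.sq_sqrt (Nat.cast_nonneg m)] at h2
  simp only [Finset.sum_const, Finset.card_univ, Fintype.card_fin, nsmul_eq_mul] at h1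
  linarith

/-! ### Choice of the exponent and conclusion. -/

lemma Real.rpow_one_sub_div_log {ε : ℝ} (hε : 0 < ε) (hε1 : ε < 1) (d : ℝ) :
    ε ^ (1 - d / Real.log (1 / ε)) = ε * Real.exp d := by
  have hlog : Real.log ε ≠ 0 := (Real.log_neg hε hε1).ne
  rw [Real.rpow_sub hε, Real.rpow_one, Real.rpow_def_of_pos hε, one_div, Real.log_inv,
    div_eq_mul_inv, ← Real.exp_neg]
  congr 2
  field_simp

lemma exp_mul_div_pow_le {C L : ℝ} (hC : 0 ≤ C) (hL : 0 ≤ L) {d : ℕ} (hd : 1 ≤ d) :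
    Real.exp d * (C * L / d) ^ d ≤ (Real.exp 1 * C * L) ^ d / (Nat.factorial d : ℝ) := by
  have hd0 : (0 : ℝ) < d := by exact_mod_cast hd
  have hfac : (Nat.factorial d : ℝ) ≤ (d : ℝ) ^ d := by exact_mod_cast Nat.factorial_le_pow d
  have e : Real.exp d = Real.exp 1 ^ d := by rw [← Real.exp_nat_mul, mul_one]
  rw [e, div_pow, ← mul_div_assoc, ← mul_pow, ← mul_assoc]
  gcongr

theorem theorem1p4 :
    ∃ c C C' : ℝ, 0 < c ∧ 0 < C ∧ 0 < C' ∧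
      ∀ (ℓ : ℕ), 2 ≤ ℓ → ∀ (n : Fin ℓ → ℕ)
        (Ω : Type*) [MeasurableSpace Ω] (P : Measure Ω) [IsProbabilityMeasure P]
        (X : (j : Fin ℓ) → Ω → EuclideanSpace ℝ (Fin (n j))),
        (∀ j, Measurable (X j)) → iIndepFun X P →
        (∀ j, IsLogConcaveVector P (X j)) → (∀ j, IsIsotropicVector P (X j)) →
        ∀ (m : ℕ), 1 ≤ m → ∀ (F : Submodule ℝ (RealTensor n)), Module.finrank ℝ F = m →
        ∀ (f : OrthonormalBasis (Fin m) ℝ F) (ε : ℝ), 0 < ε → ε < Real.exp (-c * ℓ) →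
          (∀ k : Fin m,
            P.real {ω | |inner ℝ (simpleTensor (fun j => X j ω)) (f k : RealTensor n)| ≤ ε}
              ≤ ε / (Nat.factorial (ℓ - 1) : ℝ) * (C * Real.log (1 / ε)) ^ (ℓ - 1)) ∧
          P.real {ω | ‖F.starProjection (simpleTensor (fun j => X j ω))‖ ≤ ε * √(m : ℝ)}
            ≤ min (m : ℝ) (C' ^ ℓ * Real.log (1 / ε)) *
              (ε / (Nat.factorial (ℓ - 1) : ℝ) * (C * Real.log (1 / ε)) ^ (ℓ - 1)) := by
  obtain ⟨C₀, hC₀⟩ : ∃ C₀ : ℝ, C₀ = 655360 := ⟨_, rfl⟩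
  have hC1 : 1 ≤ C₀ := by rw [hC₀]; norm_num
  have hC0 : 0 < C₀ := by linarith
  -- Taking `c = 1` gives `L > ℓ > d`, hence `p > 0`. The square of `C₀` leaves a spare `C₀ ^ d` to
  -- absorb the leading factor of the coordinate bound.
  refine ⟨1, Real.exp 1 * C₀ ^ 2, C₀, one_pos, by positivity, hC0, ?_⟩
  intro ℓ hℓ n Ω _ P _ X hX hind hlc hiso m hm F _ f ε hε hεl
  obtain ⟨d, rfl⟩ : ∃ d, ℓ = d + 1 := ⟨ℓ - 1, by omega⟩
  have hd : 1 ≤ d := by omega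
  have hd0 : (0 : ℝ) < d := by exact_mod_cast hd
  rw [Nat.add_sub_cancel]
  set L := Real.log (1 / ε) with hL
  have hε1 : ε < 1 := hεl.trans (by rw [Real.exp_lt_one_iff]; push_cast; linarith)
  have hdL : (d : ℝ) < L := by
    have := Real.log_lt_log hε hεl
    rw [Real.log_exp] at this
    rw [hL, one_div, Real.log_inv]
    push_cast at this
    linarith
  have hL0 : 0 < L := hd0.trans hdL
  -- This `p` minimises `ε ^ p * (1 - p) ^ (-d)`.
  set p := 1 - d / L with hp
  have hp0 : 0 < p := by rw [hp, sub_pos, div_lt_one hL0]; exact hdL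
  have hp1 : p < 1 := by rw [hp]; linarith [div_pos hd0 hL0]
  have hK : C₀ / (1 - p) = C₀ * L / d := by rw [hp, sub_sub_cancel, div_div_eq_mul_div]
  have hεp : ε ^ p = ε * Real.exp d := Real.rpow_one_sub_div_log hε hε1 d
  have hprob : ∀ j, IsProbabilityMeasure (P.map (X j)) := fun j =>
    Measure.isProbabilityMeasure_map (hX j).aemeasurable
  have hSB : ∀ j, HasSmallBall (P.map (X j)) C₀ := fun j =>
    hC₀ ▸ hasSmallBall_of_isLogConcaveVector (hX j) (hlc j) (hiso j)
  have hXm : Measurable fun ω j => X j ω := measurable_pi_iff.2 hX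
  have hmap : P.map (fun ω j => X j ω) = Measure.pi fun j => P.map (X j) :=
    hind.map_fun_eq_pi_map fun j => (hX j).aemeasurable
  have htransfer : ∀ (S : Set ((j : Fin (d + 1)) → EuclideanSpace ℝ (Fin (n j)))) (b : ℝ),
      0 ≤ b → (Measure.pi fun j => P.map (X j)) S ≤ ENNReal.ofReal b →
      P.real ((fun ω j => X j ω) ⁻¹' S) ≤ b := by
    intro S b hb h
    refine ENNReal.toReal_le_of_le_ofReal hb ((Measure.le_map_apply hXm.aemeasurable S).trans ?_)
    rwa [hmap]
  set B := ε / (Nat.factorial d : ℝ) * (Real.exp 1 * C₀ ^ 2 * L) ^ d with hB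
  have hpow := exp_mul_div_pow_le hC0.le hL0.le hd
  have hC₀d : C₀ ≤ C₀ ^ d := le_self_pow₀ hC1 (by omega)
  have hBeq : B = ε * (C₀ ^ d * ((Real.exp 1 * C₀ * L) ^ d / (Nat.factorial d : ℝ))) := by
    rw [hB, mul_div_assoc', ← mul_pow]; ring
  have hcoord : ∀ k : Fin m,
      P.real {ω | |inner ℝ (simpleTensor (fun j => X j ω)) (f k : RealTensor n)| ≤ ε} ≤ B := by
    intro k
    have h := HasSmallBall.measure_pi_abs_inner_le hC1 hp0 hp1 hSB (T := (f k : RealTensor n))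
      (f.norm_eq_one k) hε
    rw [hK, hεp] at h
    refine (htransfer _ _ (by positivity) h).trans ?_
    rw [hBeq]
    calc C₀ * (ε * Real.exp d) * (C₀ * L / d) ^ d
        = ε * (C₀ * (Real.exp d * (C₀ * L / d) ^ d)) := by ring
      _ ≤ _ := by gcongr
  refine ⟨hcoord, ?_⟩
  have hB0 : 0 ≤ B := by positivity
  rw [min_mul_of_nonneg _ _ hB0]
  refine le_min ?_ ?_
  · calc P.real {ω | ‖F.starProjection (simpleTensor (fun j => X j ω))‖ ≤ ε * √(m : ℝ)}
        ≤ P.real (⋃ k ∈ (Finset.univ : Finset (Fin m)),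
            {ω | |inner ℝ (simpleTensor (fun j => X j ω)) (f k : RealTensor n)| ≤ ε}) := by
          refine measureReal_mono (fun ω hω => ?_) (measure_ne_top _ _)
          obtain ⟨k, hk⟩ := f.exists_abs_inner_le_of_norm_starProjection_le hm hε hω
          simp only [Set.mem_iUnion]
          exact ⟨k, Finset.mem_univ k, hk⟩
      _ ≤ ∑ k, P.real {ω | |inner ℝ (simpleTensor (fun j => X j ω)) (f k : RealTensor n)| ≤ ε} :=
          measureReal_biUnion_finset_le _ _
      _ ≤ ∑ _k : Fin m, B := Finset.sum_le_sum fun k _ => hcoord k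
      _ = m * B := by simp
  · have h := HasSmallBall.measure_pi_norm_starProjection_le hC1 hp0 hp1 hSB hm f hε
    rw [hK, hεp] at h
    refine (htransfer _ _ (by positivity) h).trans ?_
    rw [hBeq]
    have hd1 : (1 : ℝ) ≤ d := by exact_mod_cast hd
    -- The one power more than in the coordinate bound is the factor `C₀ * L / d`, absorbed by `C' ^
    -- ℓ * L`.
    calc ε * Real.exp d * (C₀ * L / d) ^ (d + 1)
        = (C₀ * L / d) * (ε * (1 * (Real.exp d * (C₀ * L / d) ^ d))) := by ring
      _ ≤ (C₀ ^ (d + 1) * L) *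
          (ε * (C₀ ^ d * ((Real.exp 1 * C₀ * L) ^ d / (Nat.factorial d : ℝ)))) := by
          gcongr
          · calc C₀ * L / d ≤ C₀ * L := div_le_self (by positivity) hd1
              _ ≤ C₀ ^ (d + 1) * L := by
                gcongr
                exact le_self_pow₀ hC1 (by omega)
          · exact one_le_pow₀ hC1
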